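/- **Setting.** For $0<|q|<1$ and $n\ge 1$ let $$E_{2n}(q)=1-\frac{4n}{B_{2n}}\sum_{k\ge1}\frac{k^{2n-1}q^k}{1-q^k},\qquad \Delta(q)=\eta(q)^{24}=q\prod_{k\ge1}(1-q^k)^{24},$$ with $B_m$ the Bernoulli numbers. On the domain $\mathcal D=\{(q,\omega_A)\in\mathbb C^2: 0<|q|<1,\ \omega_A\neq0\}$ put $$t=-\frac12\cdot\frac{4\pi^4}{3\omega_A^4}E_4(q),\qquad \nu=\Bigl(\frac{2\pi i}{\omega_A}\Bigr)^5\frac{E_6(q)-E_2(q)E_4(q)}{360},\qquad \frac{\xi}{E_4}=-\frac{1}{2\Delta(q)}\Bigl(\frac{\omega_A}{2\pi i}\Bigr)^5 .$$ The pair $(t,\nu)$ is used as a system of local coordinates on $\mathcal D$, and $\partial/\partial\nu$ denotes the derivative with respect to $\nu$ at fixed $t$. (Here $q$ is the nome and $\omega_A$ the $A$-period of $dx/y$ on the elliptic curve $y^2=4x^3+2tx+u$, and $\nu=\frac1{2\pi i}\oint_A y\,dx$.) Let $\beta\in\mathbb C$, $\beta\neq0$, and let $$F_1^{(\beta)}=-\frac12\ln\omega_A-\frac{\beta^2+\beta^{-2}}{24}\ln\frac{\Delta(q)}{\omega_A^{12}},$$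 a multivalued function, considered locally and up to an additive constant. For $g\ge2$ consider functions on $\mathcal D$ of the form $$F_g^{(\beta)}=\Bigl(\frac{\xi}{E_4}\Bigr)^{2g-2}P_g(E_2,E_4,E_6),\qquad P_g=\sum_{k=0}^{3(g-1)}\ \sum_{\substack{a,b\ge0\\4a+6b+2k=14(g-1)}}C_{a,b,k}\,E_4^aE_6^bE_2^k,\quad C_{a,b,k}\in\mathbb C,$$ and write $\partial F_g^{(\beta)}/\partial E_2=(\xi/E_4)^{2g-2}\,(\partial P_g/\partial E_2)(E_2,E_4,E_6)$. Let $d_g=\dim\mathcal M_{14(g-1)}$ be the dimension of the space of modular forms of weight $14(g-1)$ for $\mathrm{SL}_2(\mathbb Z)$, and let $$\kappa_g^{(\beta)}=-(2g-3)!\sum_{h=0}^{g}\hat B_{2h}\hat B_{2g-2h}\,\beta^{2g-4h},\qquad \hat B_m=\bigl(1-2^{1-m}\bigr)\frac{B_m}{m!}.$$ **Theorem.** For every $\beta\ne 0$, the holomorphic anomaly equations $$\frac{\partial F_g^{(\beta)}}{\partial E_2}=-\frac1{24}\Bigl[\frac{\partial^2F_{g-1}^{(\beta)}}{\partial\nu^2}+\sum_{h=1}^{g-1}\frac{\partial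 F_h^{(\beta)}}{\partial\nu}\frac{\partial F_{g-h}^{(\beta)}}{\partial\nu}\Bigr],\qquad g\ge2,$$ on $\mathcal D$, supplemented with the $\beta$-deformed weak conifold gap conditions $$\nu^{2g-2}F_g^{(\beta)}=\kappa_g^{(\beta)}+O(q^{d_g})\qquad(q\to0,\ \text{at any fixed }\omega_A),\qquad g\ge2,$$ define $F_g^{(\beta)}$ uniquely by recursion in $g$, starting from $F_1^{(\beta)}$. That is, there is a sequence $(F_g^{(\beta)},P_g)_{g\ge2}$ of this form which satisfies all these conditions; and for every $g\ge2$, if functions $F_2',\dots,F_g'$ of this form with polynomials $P_2',\dots,P_g'$ satisfy the conditions in genus $2,\dots,g$, then $P_g'=P_g$ as polynomials and $F_g'=F_g^{(\beta)}$ on $\mathcal D$. -/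

import Mathlib

open scoped MatrixGroups Topology

noncomputable section

/-- The Eisenstein series
`E_{2n}(q) = 1 - (4n / B_{2n}) ∑_{k ≥ 1} k^{2n-1} q^k / (1 - q^k)`, for `‖q‖ < 1` and `n ≥ 1`. -/
def eisensteinQ (n : ℕ) (q : ℂ) : ℂ :=
  1 - 4 * (n : ℂ) / ((bernoulli (2 * n) : ℚ) : ℂ) *
    ∑' k : ℕ, ((k : ℂ) + 1) ^ (2 * n - 1) * q ^ (k + 1) / (1 - q ^ (k + 1))

/-- The cusp form `Δ(q) = η(q)^24 = q ∏_{k ≥ 1} (1 - q^k)^24`. -/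
def deltaQ (q : ℂ) : ℂ := q * ∏' k : ℕ, (1 - q ^ (k + 1)) ^ 24

/-- The domain of the pair of parameters `(q, ω_A)`: `0 < ‖q‖ < 1` and `ω_A ≠ 0`. -/
def paramDomain : Set (ℂ × ℂ) := {p | 0 < ‖p.1‖ ∧ ‖p.1‖ < 1 ∧ p.2 ≠ 0}

/-- The curve modulus `t = - g_2 / 2`, where `g_2 = 4 π^4 E_4 / (3 ω_A^4)`. -/
def tParam (p : ℂ × ℂ) : ℂ :=
  -(4 * (Real.pi : ℂ) ^ 4 / (3 * p.2 ^ 4) * eisensteinQ 2 p.1) / 2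

/-- The normalized `A`-period `ν = (2πi / ω_A)^5 (E_6 - E_2 E_4) / 360`. -/
def nuParam (p : ℂ × ℂ) : ℂ :=
  (2 * (Real.pi : ℂ) * Complex.I / p.2) ^ 5 *
    (eisensteinQ 3 p.1 - eisensteinQ 1 p.1 * eisensteinQ 2 p.1) / 360

/-- The change of parameters `(q, ω_A) ↦ (t, ν)`. -/
def tNu (p : ℂ × ℂ) : ℂ × ℂ := (tParam p, nuParam p)

/-- The derivative `∂F/∂ν` at fixed `t` of a function `F` of `(q, ω_A)`, in the local coordinates
`(t, ν)`: the derivative of `F` along the tangent vector `v` with `dt(v) = 0` and `dν(v) = 1`. -/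
def dNu (F : ℂ × ℂ → ℂ) (p : ℂ × ℂ) : ℂ :=
  fderiv ℂ F p ((fderiv ℂ tNu p).inverse (0, 1))

/-- The quotient `ξ / E_4 = - (1 / (2 η^24)) (ω_A / (2πi))^5`, where
`ξ = - (1 / (2 η^24)) (ω_A / (2πi))^5 E_4` is the Yukawa coupling. -/
def xiOverE4 (p : ℂ × ℂ) : ℂ :=
  -(1 / (2 * deltaQ p.1)) * (p.2 / (2 * (Real.pi : ℂ) * Complex.I)) ^ 5

/-- The value `P(E_2(q), E_4(q), E_6(q))`; the variables `0, 1, 2` stand for `E_2, E_4, E_6`. -/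
def evalE (P : MvPolynomial (Fin 3) ℂ) (q : ℂ) : ℂ :=
  MvPolynomial.eval ![eisensteinQ 1 q, eisensteinQ 2 q, eisensteinQ 3 q] P

/-- `F` has near `p` the form
`F = - (1/2) ln ω_A - (β^2 + β^{-2})/24 · ln (Δ(q) / ω_A^12) + const`,
for some continuous branches `lω` and `lΔ` of the two logarithms. -/
def IsFreeEnergyOneNear (β : ℂ) (p : ℂ × ℂ) (F : ℂ × ℂ → ℂ) : Prop :=
  ∃ (lω lΔ : ℂ × ℂ → ℂ) (c : ℂ), ∀ᶠ x in 𝓝 p,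
    ContinuousAt lω x ∧ Complex.exp (lω x) = x.2 ∧
    ContinuousAt lΔ x ∧ Complex.exp (lΔ x) = deltaQ x.1 / x.2 ^ 12 ∧
    F x = -(1 / 2) * lω x - (β ^ 2 + (β ^ 2)⁻¹) / 24 * lΔ x + c

/-- `F_g = (ξ / E_4)^{2g-2} P_g(E_2, E_4, E_6)`, where each monomial `E_2^k E_4^a E_6^b` of `P_g` has
`2k + 4a + 6b = 14(g-1)` and `k ≤ 3(g-1)`. -/
structure HasQuasiModularForm (g : ℕ) (Fg : ℂ × ℂ → ℂ) (Pg : MvPolynomial (Fin 3) ℂ) : Prop where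
  weight : ∀ m ∈ Pg.support, 2 * m 0 + 4 * m 1 + 6 * m 2 = 14 * (g - 1)
  depth : ∀ m ∈ Pg.support, m 0 ≤ 3 * (g - 1)
  eq : ∀ p ∈ paramDomain, Fg p = xiOverE4 p ^ (2 * g - 2) * evalE Pg p.1

/-- `- (1/24) [∂²F_{g-1}/∂ν² + ∑_{h=1}^{g-1} ∂F_h/∂ν · ∂F_{g-h}/∂ν]`. -/
def anomalyRHS (F : ℕ → ℂ × ℂ → ℂ) (g : ℕ) (p : ℂ × ℂ) : ℂ :=
  -(1 / 24) * (dNu (dNu (F (g - 1))) p +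
    ∑ h ∈ Finset.Icc 1 (g - 1), dNu (F h) p * dNu (F (g - h)) p)

/-- The holomorphic anomaly equation in genus `g`,
`∂F_g/∂E_2 = - (1/24) [∂²F_{g-1}/∂ν² + ∑_{h=1}^{g-1} ∂F_h/∂ν · ∂F_{g-h}/∂ν]`,
where `F_g = (ξ / E_4)^{2g-2} P_g(E_2, E_4, E_6)`, the derivative `∂F_g/∂E_2` differentiates only the
polynomial `P_g`, and `F_1` is the multivalued function
`- (1/2) ln ω_A - (β^2 + β^{-2})/24 · ln (Δ(q) / ω_A^12)`: the equation holds at each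
point with any local branch `F₁` of it in genus one (the entry `F 1` is replaced by `F₁`). -/
def HolomorphicAnomaly (β : ℂ) (F : ℕ → ℂ × ℂ → ℂ) (g : ℕ) (Pg : MvPolynomial (Fin 3) ℂ) : Prop :=
  ∀ p ∈ paramDomain, ∀ F₁ : ℂ × ℂ → ℂ, IsFreeEnergyOneNear β p F₁ →
    xiOverE4 p ^ (2 * g - 2) * evalE (MvPolynomial.pderiv 0 Pg) p.1 =
      anomalyRHS (Function.update F 1 F₁) g p

/-- `d_g = dim M_{14(g-1)}`, the dimension of the space of modular forms of weight `14(g-1)` for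
`SL₂(ℤ)`. -/
def gapOrder (g : ℕ) : ℕ := Module.finrank ℂ (ModularForm 𝒮ℒ (14 * ((g : ℤ) - 1)))

/-- `B̂_m = (1 - 2^{1-m}) B_m / m!`. -/
def bernoulliHat (m : ℕ) : ℂ :=
  (1 - (2 : ℂ) ^ (1 - (m : ℤ))) * ((bernoulli m : ℚ) : ℂ) / (m.factorial : ℂ)

/-- `κ_g^{(β)} = - (2g-3)! ∑_{h=0}^{g} B̂_{2h} B̂_{2g-2h} β^{2g-4h}`, for `g ≥ 2`. -/
def kappaBeta (β : ℂ) (g : ℕ) : ℂ :=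
  -((2 * g - 3).factorial : ℂ) * ∑ h ∈ Finset.range (g + 1),
    bernoulliHat (2 * h) * bernoulliHat (2 * g - 2 * h) * β ^ (2 * (g : ℤ) - 4 * (h : ℤ))

/-- The `β`-deformed weak conifold gap condition `ν^{2g-2} F_g = κ_g^{(β)} + O(q^{d_g})` as `q → 0`,
`q ≠ 0`, at every fixed `ω_A ≠ 0`. -/
def WeakGap (β : ℂ) (g : ℕ) (Fg : ℂ × ℂ → ℂ) : Prop :=
  ∀ ω : ℂ, ω ≠ 0 →
    (fun q : ℂ => nuParam (q, ω) ^ (2 * g - 2) * Fg (q, ω) - kappaBeta β g)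
      =O[𝓝[≠] 0] fun q : ℂ => q ^ gapOrder g

/-- In genus `g`, the function `F_g` with its polynomial `P_g` is of quasi-modular form and
satisfies the holomorphic anomaly equation and the weak gap condition. -/
structure IsBetaFreeEnergyAt (β : ℂ) (F : ℕ → ℂ × ℂ → ℂ) (P : ℕ → MvPolynomial (Fin 3) ℂ)
    (g : ℕ) : Prop where
  form : HasQuasiModularForm g (F g) (P g)
  hae : HolomorphicAnomaly β F g (P g)
  gap : WeakGap β g (F g)

end

/-!
Write `X = ξ/E_4` and `D = q d/dq`. By Ramanujan's identities the Jacobian of `(t, ν)` with respect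
to `(q, ω_A)` is a nonvanishing multiple of `Δ`, and at fixed `t`
`∂/∂ν = X (E_4 D + (E_2 E_4 - E_6)/12 · ω_A ∂/∂ω_A)`.
Hence `∂/∂ν` sends `X^k P(E_2, E_4, E_6)` to `X^{k+1} Q(E_2, E_4, E_6)`, where `Q` is an explicit
polynomial of weight larger by `6` and of degree in `E_2` larger by at most `1`, and `∂F_1/∂ν` is
`X` times a polynomial of weight `6` (`dNu_eventuallyEq`, `dNu_genusOne`). So the right-hand side of
the anomaly equation is `X^{2g-2}` times an isobaric polynomial. Isobaric polynomials are determined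
by their values on the Eisenstein series (`isobaric_eq_zero_of_evalE`), because `E_2` is only
quasi-modular: moving a relation by the matrices `(0, -1; 1, i)` gives infinitely many values of
the variable `E_2`. The anomaly equation is therefore the identity
`∂P_g/∂E_2 = anomalyPoly β P g` of polynomials, which has isobaric solutions, unique up to the
addition of a polynomial in `E_4` and `E_6` of weight `14(g-1)`.

This ambiguity is what the gap condition fixes. The function `ν X` depends on `q` alone and is
analytic at `q = 0` with value `1`, so the gap condition prescribes the first `d_g` Taylor
coefficients of `P_g(E_2, E_4, E_6)` at `q = 0`. The polynomials in `E_4`, `E_6` of an even weight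
`n` have the basis `Δ^j E_4^a E_6^b`, with `b ≤ 1` and `12j + 4a + 6b = n`, which is triangular with
respect to the order of vanishing at `q = 0` and whose size is the dimension of the space of modular
forms of weight `n`. Prescribing that many Taylor coefficients thus selects exactly one polynomial
(`exists_evalE_isBigO`, `eq_zero_of_evalE_isBigO`). The value of `κ_g` plays no role in this.

Ramanujan's identities are obtained from the vanishing of cusp forms of weight less than `12`,
applied to the Serre derivatives of `E_4` and `E_6` and to `D E_2 - E_2²/12`.
-/

/-! ### Eisenstein series on the unit disc -/

section EisensteinDisc

open UpperHalfPlane hiding I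
open Complex ArithmeticFunction EisensteinSeries ModularForm
open scoped Real Manifold ModularForm sigma

/-- The `m`-th Taylor coefficient at `q = 0` of `eisensteinQ n`. -/
noncomputable def eisensteinCoeff (n m : ℕ) : ℂ :=
  if m = 0 then 1 else -(4 * (n : ℂ) / ((bernoulli (2 * n) : ℚ) : ℂ)) * (σ (2 * n - 1) m : ℂ)

lemma eisensteinQ_eq_sigma (n : ℕ) {q : ℂ} (hq : ‖q‖ < 1) :
    eisensteinQ n q = 1 - 4 * (n : ℂ) / ((bernoulli (2 * n) : ℚ) : ℂ) *
      ∑' m : ℕ+, (σ (2 * n - 1) m : ℂ) * q ^ (m : ℕ) := by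
  rw [← tsum_pow_div_one_sub_eq_tsum_sigma hq,
    tsum_pnat_eq_tsum_succ (f := fun k : ℕ ↦ (k : ℂ) ^ (2 * n - 1) * q ^ k / (1 - q ^ k))]
  simp [eisensteinQ]

lemma hasSum_eisensteinQ (n : ℕ) {q : ℂ} (hq : ‖q‖ < 1) :
    HasSum (fun m ↦ eisensteinCoeff n m * q ^ m) (eisensteinQ n q) := by
  have hS : Summable fun m : ℕ ↦ (σ (2 * n - 1) m : ℂ) * q ^ m := by
    apply Summable.of_norm_bounded
      (summable_norm_pow_mul_geometric_of_norm_lt_one (2 * n - 1 + 1) hq)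
    intro m
    simp only [norm_mul, Complex.norm_natCast, norm_pow]
    gcongr
    exact_mod_cast ArithmeticFunction.sigma_le_pow_succ (2 * n - 1) m
  rw [← hasSum_nat_add_iff' 1]
  have hS' := (((summable_nat_add_iff 1).mpr hS).mul_left
    (-(4 * (n : ℂ) / ((bernoulli (2 * n) : ℚ) : ℂ)))).hasSum
  convert! hS' using 1
  · ext m
    simp [eisensteinCoeff, mul_assoc]
  · rw [eisensteinQ_eq_sigma n hq,
      tsum_pnat_eq_tsum_succ (f := fun m : ℕ ↦ (σ (2 * n - 1) m : ℂ) * q ^ m), tsum_mul_left]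
    simp [eisensteinCoeff]

lemma hasFPowerSeriesOnBall_eisensteinQ (n : ℕ) :
    HasFPowerSeriesOnBall (eisensteinQ n) (.ofScalars ℂ (eisensteinCoeff n)) 0 1 := by
  constructor
  · refine le_of_forall_lt_imp_le_of_dense fun r hr ↦ ?_
    lift r to NNReal using hr.ne_top
    apply FormalMultilinearSeries.le_radius_of_summable
    simpa [mul_comm, mul_left_comm, mul_assoc] using
      (hasSum_eisensteinQ n (q := r) (by simpa using hr)).summable.norm
  · simp
  · intro y hy
    rw [← ENNReal.coe_one, Metric.eball_coe, NNReal.coe_one, mem_ball_zero_iff] at hy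
    simpa [mul_comm] using hasSum_eisensteinQ n hy

lemma analyticAt_eisensteinQ (n : ℕ) {q : ℂ} (hq : ‖q‖ < 1) : AnalyticAt ℂ (eisensteinQ n) q :=
  (hasFPowerSeriesOnBall_eisensteinQ n).analyticAt_of_mem (by
    rw [← ENNReal.coe_one, Metric.eball_coe, NNReal.coe_one, mem_ball_zero_iff]; exact hq)

lemma eisensteinQ_zero (n : ℕ) : eisensteinQ n 0 = 1 := by
  simp [eisensteinQ]

lemma deriv_eisensteinQ_two_zero : deriv (eisensteinQ 2) 0 = 240 := by
  have := (hasFPowerSeriesOnBall_eisensteinQ 2).hasFPowerSeriesAt.deriv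
  rw [this]
  norm_num [eisensteinCoeff, show bernoulli 4 = -1 / 30 by decide +kernel]

/-- The nome `q = exp (2πiτ)`. -/
noncomputable abbrev nome (τ : ℍ) : ℂ := Function.Periodic.qParam 1 τ

lemma norm_nome_lt_one (τ : ℍ) : ‖nome τ‖ < 1 :=
  Function.Periodic.norm_qParam_lt_one one_pos τ.im_pos

lemma exists_nome_eq {q : ℂ} (h0 : q ≠ 0) (h1 : ‖q‖ < 1) : ∃ τ : ℍ, nome τ = q :=
  ⟨⟨_, Function.Periodic.im_invQParam_pos_of_norm_lt_one one_pos h1 h0⟩,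
    Function.Periodic.qParam_right_inv one_ne_zero h0⟩

lemma E2_eq_eisensteinQ (τ : ℍ) : E2 τ = eisensteinQ 1 (nome τ) := by
  rw [E2_eq_tsum_cexp, eisensteinQ_eq_sigma 1 (norm_nome_lt_one τ)]
  norm_num [bernoulli_two, Function.Periodic.qParam]

lemma E4_eq_eisensteinQ (τ : ℍ) : E₄ τ = eisensteinQ 2 (nome τ) := by
  rw [EisensteinSeries.q_expansion_bernoulli _ ⟨2, rfl⟩,
    eisensteinQ_eq_sigma 2 (norm_nome_lt_one τ)]
  norm_num [Function.Periodic.qParam]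

lemma E6_eq_eisensteinQ (τ : ℍ) : E₆ τ = eisensteinQ 3 (nome τ) := by
  rw [EisensteinSeries.q_expansion_bernoulli _ ⟨3, rfl⟩,
    eisensteinQ_eq_sigma 3 (norm_nome_lt_one τ)]
  norm_num [Function.Periodic.qParam]

lemma mdifferentiable_comp_nome {f : ℂ → ℂ} (hf : ∀ q : ℂ, ‖q‖ < 1 → AnalyticAt ℂ f q) :
    MDiff (fun τ : ℍ ↦ f (nome τ)) := by
  rw [UpperHalfPlane.mdifferentiable_iff]
  intro z hz
  have h1 : DifferentiableAt ℂ (fun z ↦ f (Function.Periodic.qParam 1 z)) z :=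
    (hf _ (norm_nome_lt_one ⟨z, hz⟩)).differentiableAt.comp z (by fun_prop)
  refine (h1.congr_of_eventuallyEq ?_).differentiableWithinAt
  filter_upwards [isOpen_upperHalfPlaneSet.mem_nhds hz] with w hw
  simp [nome, ofComplex_apply_of_im_pos hw]

lemma normalizedDeriv_comp_nome {f : ℂ → ℂ} (hf : ∀ q : ℂ, ‖q‖ < 1 → AnalyticAt ℂ f q) (τ : ℍ) :
    Derivative.normalizedDerivOfComplex (fun τ : ℍ ↦ f (nome τ)) τ
      = nome τ * deriv f (nome τ) := by
  have h1 : HasDerivAt (Function.Periodic.qParam 1) (2 * π * I * nome τ) (τ : ℂ) := by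
    have := ((hasDerivAt_id (τ : ℂ)).const_mul (2 * π * I)).cexp
    convert! this using 1
    · ext z; simp [Function.Periodic.qParam]
    · simp [nome, Function.Periodic.qParam, mul_comm]
  have h2 := (hf _ (norm_nome_lt_one τ)).differentiableAt.hasDerivAt.comp (τ : ℂ) h1
  have h3 : ((fun τ : ℍ ↦ f (nome τ)) ∘ ofComplex) =ᶠ[𝓝 (τ : ℂ)]
      f ∘ Function.Periodic.qParam 1 := by
    filter_upwards [isOpen_upperHalfPlaneSet.mem_nhds τ.im_pos] with w hw
    simp [nome, ofComplex_apply_of_im_pos hw]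
  rw [Derivative.normalizedDerivOfComplex, h3.deriv_eq, h2.deriv]
  have := two_pi_I_ne_zero
  field_simp

open ModularGroup in
/-- A holomorphic function on the upper half-plane that is invariant under `S` and `T` in weight
less than `12` and tends to `0` at the cusp vanishes. -/
lemma eq_zero_of_weight_lt_twelve {k : ℤ} (hk : k < 12) {G : ℍ → ℂ} (hG : MDiff G)
    (hS : G ∣[k] S = G) (hT : G ∣[k] T = G) {g : ℂ → ℂ} (hg : ContinuousAt g 0) (hg0 : g 0 = 0)
    (hgG : ∀ τ, G τ = g (nome τ)) (τ : ℍ) : G τ = 0 := by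
  have hz : IsZeroAtImInfty G := by
    have := hg.tendsto.comp (qParam_tendsto_atImInfty one_pos)
    rw [hg0] at this
    exact this.congr fun z ↦ (hgG z).symm
  let C : CuspForm 𝒮ℒ k :=
    { toFun := G
      slash_action_eq' := by
        rintro A ⟨A, rfl⟩
        exact SlashInvariantForm.slash_action_generators_SL2Z hS hT A
      holo' := hG
      zero_at_cusps' := by
        intro c hc
        rw [Subgroup.IsArithmetic.isCusp_iff_isCusp_SL2Z] at hc
        rw [OnePoint.isZeroAt_iff_forall_SL2Z hc]
        intro γ _
        rw [SlashInvariantForm.slash_action_generators_SL2Z hS hT]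
        exact hz }
  have hC : C = 0 := rank_zero_iff_forall_zero.mp (CuspForm.rank_eq_zero_of_weight_lt_twelve hk) C
  exact congrArg (fun f : CuspForm 𝒮ℒ k ↦ f τ) hC


lemma slash_invariant_levelOne {k : ℤ} (f : ModularForm 𝒮ℒ k) (γ : SL(2, ℤ)) :
    (f : ℍ → ℂ) ∣[k] γ = f :=
  SlashInvariantFormClass.slash_action_eq f _ ⟨γ, rfl⟩

/-- The transformation law of `E_2`. -/
lemma E2_slash_apply (γ : SL(2, ℤ)) (z : ℍ) :
    (E2 ∣[(2 : ℤ)] γ) z = E2 z + 12 * (2 * π * I)⁻¹ * (γ 1 0 / denom γ z) := by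
  rw [E2_slash_action]
  have := two_pi_I_ne_zero
  have hI := I_sq
  have hp : (π : ℂ) ≠ 0 := by exact_mod_cast Real.pi_ne_zero
  simp only [Pi.sub_apply, Pi.smul_apply, D2, riemannZeta_two, smul_eq_mul]
  field_simp
  linear_combination (-(12 : ℂ) * γ 1 0) * hI

lemma normalizedDeriv_const_div_denom (γ : SL(2, ℤ)) (z : ℍ) :
    Derivative.normalizedDerivOfComplex (fun z : ℍ ↦ (γ 1 0 : ℂ) / denom γ z) z
      = -(2 * π * I)⁻¹ * (γ 1 0 / denom γ z) ^ 2 := by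
  have h0 : denom γ z ≠ 0 := denom_ne_zero _ _
  have h1 : HasDerivAt (fun w : ℂ ↦ (γ 1 0 : ℂ) / ((γ 1 0 : ℂ) * w + γ 1 1))
      (-(γ 1 0 / denom γ z) ^ 2) (z : ℂ) := by
    have hd : ((γ 1 0 : ℂ) * z + γ 1 1) = denom γ z := by simp [denom]
    have h2 := ((hasDerivAt_id (z : ℂ)).const_mul (γ 1 0 : ℂ)).add_const (γ 1 1 : ℂ)
    have := (hasDerivAt_const (z : ℂ) (γ 1 0 : ℂ)).div h2 (by simp [hd, h0])
    convert! this using 1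
    simp only [id, hd]
    field_simp
    ring
  have h3 : ((fun z : ℍ ↦ (γ 1 0 : ℂ) / denom γ z) ∘ ofComplex) =ᶠ[𝓝 (z : ℂ)]
      fun w : ℂ ↦ (γ 1 0 : ℂ) / ((γ 1 0 : ℂ) * w + γ 1 1) := by
    filter_upwards [isOpen_upperHalfPlaneSet.mem_nhds z.im_pos] with w hw
    simp [ofComplex_apply_of_im_pos hw, denom]
  rw [Derivative.normalizedDerivOfComplex, h3.deriv_eq, h1.deriv]
  ring

lemma mdifferentiable_const_div_denom (γ : SL(2, ℤ)) :
    MDiff (fun z : ℍ ↦ (γ 1 0 : ℂ) / denom γ z) := by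
  rw [UpperHalfPlane.mdifferentiable_iff]
  intro z hz
  have h0 : denom γ z ≠ 0 := denom_ne_zero γ (⟨z, hz⟩ : ℍ)
  have h1 : DifferentiableAt ℂ (fun w : ℂ ↦ (γ 1 0 : ℂ) / ((γ 1 0 : ℂ) * w + γ 1 1)) z :=
    (differentiableAt_const _).div (by fun_prop) (by simpa [denom] using h0)
  refine (h1.congr_of_eventuallyEq ?_).differentiableWithinAt
  filter_upwards [isOpen_upperHalfPlaneSet.mem_nhds hz] with w hw
  simp [ofComplex_apply_of_im_pos hw, denom]

open Derivative in
/-- `D E₂ - E₂² / 12` is invariant in weight `4`: the inhomogeneous terms in the transformation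
laws of `D E₂` and of `E₂²` cancel. -/
lemma deriv_E2_sub_sq_slash (γ : SL(2, ℤ)) :
    (fun z ↦ D E2 z - E2 z ^ 2 / 12 : ℍ → ℂ) ∣[(4 : ℤ)] γ = fun z ↦ D E2 z - E2 z ^ 2 / 12 := by
  ext z
  have h1 := congrFun (normalizedDerivOfComplex_SL_slash (k := 2) E2_mdifferentiable (γ := γ)) z
  have h2 : (E2 ∣[(2 : ℤ)] γ) = E2 + (12 * (2 * π * I)⁻¹) • fun z : ℍ ↦ (γ 1 0 / denom γ z) := by
    ext z
    rw [E2_slash_apply]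
    simp
  have h3 := E2_slash_apply γ z
  rw [h2, normalizedDerivOfComplex_add _ _ E2_mdifferentiable
      ((mdifferentiable_const_div_denom γ).const_smul _),
    normalizedDerivOfComplex_smul _ _ (mdifferentiable_const_div_denom γ)] at h1
  simp only [Pi.add_apply, Pi.sub_apply, Pi.smul_apply, normalizedDeriv_const_div_denom,
    smul_eq_mul] at h1
  rw [ModularForm.SL_slash_apply] at h1 h3 ⊢
  have h4 : denom γ z ^ (-(4 : ℤ)) = (denom γ z ^ (-(2 : ℤ))) ^ 2 := by
    rw [← zpow_natCast, ← zpow_mul]; norm_num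
  rw [show (2 : ℤ) + 2 = 4 by norm_num, h4] at h1
  rw [h4]
  push_cast at h1
  generalize denom γ z ^ (-(2 : ℤ)) = d at *
  generalize (γ 1 0 : ℂ) / denom γ z = u at *
  generalize (2 * π * I : ℂ)⁻¹ = c at *
  linear_combination -h1 - (E2 (γ • z) * d + E2 z + 12 * c * u) / 12 * h3

end EisensteinDisc

/-! ### Ramanujan's identities and the discriminant -/

section Ramanujan

open UpperHalfPlane hiding I
open Complex ArithmeticFunction EisensteinSeries ModularForm
open scoped Real Manifold ModularForm sigma
open Derivative ModularGroup

lemma analyticAt_mul_deriv {f : ℂ → ℂ} (hf : ∀ q : ℂ, ‖q‖ < 1 → AnalyticAt ℂ f q) (q : ℂ)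
    (hq : ‖q‖ < 1) : AnalyticAt ℂ (fun q ↦ q * deriv f q) q :=
  analyticAt_id.mul (hf q hq).deriv

/-- A level one form of weight less than `12`, given on the disc by a function `g` of the nome that
vanishes at `0`, is zero; hence so is `g`. -/
lemma disc_eq_zero_of_weight_lt_twelve {k : ℤ} (hk : k < 12) {g : ℂ → ℂ}
    (hg : ∀ q : ℂ, ‖q‖ < 1 → AnalyticAt ℂ g q) (hg0 : g 0 = 0)
    (hinv : ∀ γ : SL(2, ℤ), (fun τ : ℍ ↦ g (nome τ)) ∣[k] γ = fun τ : ℍ ↦ g (nome τ))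
    {q : ℂ} (hq : ‖q‖ < 1) : g q = 0 := by
  rcases eq_or_ne q 0 with rfl | h0
  · exact hg0
  · obtain ⟨τ, rfl⟩ := exists_nome_eq h0 hq
    exact eq_zero_of_weight_lt_twelve hk (mdifferentiable_comp_nome hg) (hinv S) (hinv T)
      (hg 0 (by simp)).continuousAt hg0 (fun _ ↦ rfl) τ

/-- Ramanujan's identity `D E_2 = (E_2² - E_4) / 12`. -/
lemma mul_deriv_eisensteinQ_one {q : ℂ} (hq : ‖q‖ < 1) :
    q * deriv (eisensteinQ 1) q = (eisensteinQ 1 q ^ 2 - eisensteinQ 2 q) / 12 := by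
  have h := disc_eq_zero_of_weight_lt_twelve (k := 4) (by norm_num)
    (g := fun q ↦ q * deriv (eisensteinQ 1) q - eisensteinQ 1 q ^ 2 / 12 + 12⁻¹ * eisensteinQ 2 q)
    (fun q hq ↦ ((analyticAt_mul_deriv (fun _ ↦ analyticAt_eisensteinQ 1) q hq).sub
      (((analyticAt_eisensteinQ 1 hq).pow 2).div_const)).add
      (analyticAt_const.mul (analyticAt_eisensteinQ 2 hq)))
    (by norm_num [eisensteinQ_zero]) ?_ hq
  · linear_combination h
  · intro γ
    have h1 : (fun τ : ℍ ↦ nome τ * deriv (eisensteinQ 1) (nome τ)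
        - eisensteinQ 1 (nome τ) ^ 2 / 12 + 12⁻¹ * eisensteinQ 2 (nome τ)) =
        (fun z ↦ D E2 z - E2 z ^ 2 / 12) + (12⁻¹ : ℂ) • (E₄ : ℍ → ℂ) := by
      ext τ
      rw [← normalizedDeriv_comp_nome (fun _ ↦ analyticAt_eisensteinQ 1)]
      simp only [← E2_eq_eisensteinQ, ← E4_eq_eisensteinQ]
      rfl
    rw [h1, SlashAction.add_slash, ModularForm.SL_smul_slash, deriv_E2_sub_sq_slash,
      slash_invariant_levelOne]

/-- Ramanujan's identity `D E_4 = (E_2 E_4 - E_6) / 3`. -/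
lemma mul_deriv_eisensteinQ_two {q : ℂ} (hq : ‖q‖ < 1) :
    q * deriv (eisensteinQ 2) q = (eisensteinQ 1 q * eisensteinQ 2 q - eisensteinQ 3 q) / 3 := by
  have h := disc_eq_zero_of_weight_lt_twelve (k := 6) (by norm_num)
    (g := fun q ↦ q * deriv (eisensteinQ 2) q - ((4 : ℤ) : ℂ) * 12⁻¹ * eisensteinQ 1 q *
      eisensteinQ 2 q + 3⁻¹ * eisensteinQ 3 q)
    (fun q hq ↦ ((analyticAt_mul_deriv (fun _ ↦ analyticAt_eisensteinQ 2) q hq).sub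
      ((analyticAt_const.mul (analyticAt_eisensteinQ 1 hq)).mul (analyticAt_eisensteinQ 2 hq))).add
      (analyticAt_const.mul (analyticAt_eisensteinQ 3 hq)))
    (by norm_num [eisensteinQ_zero]) ?_ hq
  · push_cast at h
    linear_combination h
  · intro γ
    have h1 : (fun τ : ℍ ↦ nome τ * deriv (eisensteinQ 2) (nome τ)
        - ((4 : ℤ) : ℂ) * 12⁻¹ * eisensteinQ 1 (nome τ) * eisensteinQ 2 (nome τ)
        + 3⁻¹ * eisensteinQ 3 (nome τ)) =
        serreDerivative ((4 : ℤ) : ℂ) E₄ + (3⁻¹ : ℂ) • (E₆ : ℍ → ℂ) := by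
      ext τ
      rw [← normalizedDeriv_comp_nome (fun _ ↦ analyticAt_eisensteinQ 2)]
      simp only [← E2_eq_eisensteinQ, ← E4_eq_eisensteinQ, ← E6_eq_eisensteinQ]
      rfl
    rw [h1, SlashAction.add_slash, ModularForm.SL_smul_slash, slash_invariant_levelOne]
    congr 1
    exact serreDerivative_slash_invariant (k := 4) E₄.holo' (slash_invariant_levelOne E₄ γ)

/-- Ramanujan's identity `D E_6 = (E_2 E_6 - E_4²) / 2`. -/
lemma mul_deriv_eisensteinQ_three {q : ℂ} (hq : ‖q‖ < 1) :
    q * deriv (eisensteinQ 3) q = (eisensteinQ 1 q * eisensteinQ 3 q - eisensteinQ 2 q ^ 2) / 2 := by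
  have h := disc_eq_zero_of_weight_lt_twelve (k := 8) (by norm_num)
    (g := fun q ↦ q * deriv (eisensteinQ 3) q - ((6 : ℤ) : ℂ) * 12⁻¹ * eisensteinQ 1 q *
      eisensteinQ 3 q + 2⁻¹ * (eisensteinQ 2 q * eisensteinQ 2 q))
    (fun q hq ↦ ((analyticAt_mul_deriv (fun _ ↦ analyticAt_eisensteinQ 3) q hq).sub
      ((analyticAt_const.mul (analyticAt_eisensteinQ 1 hq)).mul (analyticAt_eisensteinQ 3 hq))).add
      (analyticAt_const.mul ((analyticAt_eisensteinQ 2 hq).mul (analyticAt_eisensteinQ 2 hq))))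
    (by norm_num [eisensteinQ_zero]) ?_ hq
  · push_cast at h
    linear_combination h
  · intro γ
    have h1 : (fun τ : ℍ ↦ nome τ * deriv (eisensteinQ 3) (nome τ)
        - ((6 : ℤ) : ℂ) * 12⁻¹ * eisensteinQ 1 (nome τ) * eisensteinQ 3 (nome τ)
        + 2⁻¹ * (eisensteinQ 2 (nome τ) * eisensteinQ 2 (nome τ))) =
        serreDerivative ((6 : ℤ) : ℂ) E₆ + (2⁻¹ : ℂ) • (E₄.mul E₄ : ℍ → ℂ) := by
      ext τ
      rw [← normalizedDeriv_comp_nome (fun _ ↦ analyticAt_eisensteinQ 3)]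
      simp only [← E2_eq_eisensteinQ, ← E4_eq_eisensteinQ, ← E6_eq_eisensteinQ]
      rfl
    rw [h1, SlashAction.add_slash, ModularForm.SL_smul_slash]
    congr 1
    · exact serreDerivative_slash_invariant (k := 6) E₆.holo' (slash_invariant_levelOne E₆ γ)
    · exact congrArg _ (slash_invariant_levelOne (E₄.mul E₄) γ)

lemma deltaQ_nome (τ : ℍ) : deltaQ (nome τ) = ModularForm.discriminant τ := by
  rw [discriminant_eq_q_prod, deltaQ]

lemma eisensteinQ_cube_sub_sq {q : ℂ} (hq : ‖q‖ < 1) :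
    eisensteinQ 2 q ^ 3 - eisensteinQ 3 q ^ 2 = 1728 * deltaQ q := by
  rcases eq_or_ne q 0 with rfl | h0
  · simp [eisensteinQ_zero, deltaQ]
  · obtain ⟨τ, rfl⟩ := exists_nome_eq h0 hq
    rw [deltaQ_nome, discriminant_eq_E₄_cube_sub_E₆_sq, E4_eq_eisensteinQ, E6_eq_eisensteinQ]
    ring

lemma deltaQ_ne_zero {q : ℂ} (h0 : q ≠ 0) (hq : ‖q‖ < 1) : deltaQ q ≠ 0 := by
  obtain ⟨τ, rfl⟩ := exists_nome_eq h0 hq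
  rw [deltaQ_nome]
  exact discriminant_ne_zero τ

lemma differentiableAt_deltaQ {q : ℂ} (hq : ‖q‖ < 1) : DifferentiableAt ℂ deltaQ q :=
  differentiableAt_id.mul <| (differentiableOn_tprod_one_sub_pow_pow 24).differentiableAt
    (Metric.isOpen_ball.mem_nhds (by simpa using hq))

/-- `D Δ = E_2 Δ`, read off from `1728 Δ = E_4³ - E_6²` and Ramanujan's identities. -/
lemma mul_deriv_deltaQ {q : ℂ} (hq : ‖q‖ < 1) :
    q * deriv deltaQ q = eisensteinQ 1 q * deltaQ q := by
  have h : (fun q ↦ eisensteinQ 2 q ^ 3 - eisensteinQ 3 q ^ 2) =ᶠ[𝓝 q] fun q ↦ 1728 * deltaQ q := by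
    filter_upwards [Metric.isOpen_ball.mem_nhds (show q ∈ Metric.ball 0 1 by simpa using hq)]
      with x hx
    exact eisensteinQ_cube_sub_sq (by simpa using hx)
  have h2 := (analyticAt_eisensteinQ 2 hq).differentiableAt
  have h3 := (analyticAt_eisensteinQ 3 hq).differentiableAt
  have h' := h.deriv_eq
  rw [((h2.hasDerivAt.fun_pow 3).fun_sub (h3.hasDerivAt.fun_pow 2)).deriv,
    ((differentiableAt_deltaQ hq).hasDerivAt.const_mul _).deriv] at h'
  have e2 := mul_deriv_eisensteinQ_two hq
  have e3 := mul_deriv_eisensteinQ_three hq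
  have ed := eisensteinQ_cube_sub_sq hq
  norm_num at h'
  linear_combination (-q * h' + 3 * eisensteinQ 2 q ^ 2 * e2 - 2 * eisensteinQ 3 q * e3
    + eisensteinQ 1 q * ed) / 1728

/-- The product `∏ (1 - q^k)^24`. -/
noncomputable def eulerProd (q : ℂ) : ℂ := ∏' k : ℕ, (1 - q ^ (k + 1)) ^ 24

lemma deltaQ_eq_mul_eulerProd (q : ℂ) : deltaQ q = q * eulerProd q := rfl

lemma eulerProd_zero : eulerProd 0 = 1 := by simp [eulerProd]

lemma analyticAt_eulerProd_zero : AnalyticAt ℂ eulerProd 0 :=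
  (differentiableOn_tprod_one_sub_pow_pow 24).analyticAt (Metric.ball_mem_nhds 0 one_pos)

end Ramanujan

/-! ### Isobaric polynomials in the Eisenstein series -/

section Isobaric

open MvPolynomial

/-- The polynomials in `E_2, E_4, E_6` (variables `0, 1, 2`) that are isobaric of weight `n` and of
degree at most `N` in `E_2`. -/
noncomputable def isobaric (n N : ℕ) : Submodule ℂ (MvPolynomial (Fin 3) ℂ) where
  carrier := {P | ∀ m ∈ P.support, 2 * m 0 + 4 * m 1 + 6 * m 2 = n ∧ m 0 ≤ N}
  add_mem' {P Q} hP hQ m hm := by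
    classical
    rcases Finset.mem_union.mp (support_add hm) with h | h
    exacts [hP m h, hQ m h]
  zero_mem' m hm := by simp at hm
  smul_mem' c P hP m hm := hP m (support_smul hm)

variable {n N : ℕ} {P Q : MvPolynomial (Fin 3) ℂ}

lemma isobaric_mono {N' : ℕ} (h : N ≤ N') (hP : P ∈ isobaric n N) : P ∈ isobaric n N' :=
  fun m hm ↦ ⟨(hP m hm).1, (hP m hm).2.trans h⟩

lemma isobaric_mul {n' N' : ℕ} (hP : P ∈ isobaric n N) (hQ : Q ∈ isobaric n' N') :
    P * Q ∈ isobaric (n + n') (N + N') := by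
  classical
  intro m hm
  obtain ⟨a, ha, b, hb, rfl⟩ := Finset.mem_add.mp (support_mul P Q hm)
  have h1 := hP a ha
  have h2 := hQ b hb
  simp only [Finsupp.add_apply]
  omega

lemma monomial_mem_isobaric {m : Fin 3 →₀ ℕ} (c : ℂ) (h : 2 * m 0 + 4 * m 1 + 6 * m 2 = n)
    (hN : m 0 ≤ N) : monomial m c ∈ isobaric n N := by
  intro d hd
  obtain rfl : d = m := by simpa using support_monomial_subset hd
  exact ⟨h, hN⟩

lemma X0_mem_isobaric : (X 0 : MvPolynomial (Fin 3) ℂ) ∈ isobaric 2 1 :=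
  monomial_mem_isobaric _ (by simp) (by simp)

lemma X1_mem_isobaric : (X 1 : MvPolynomial (Fin 3) ℂ) ∈ isobaric 4 0 :=
  monomial_mem_isobaric _ (by simp) (by simp)

lemma X2_mem_isobaric : (X 2 : MvPolynomial (Fin 3) ℂ) ∈ isobaric 6 0 :=
  monomial_mem_isobaric _ (by simp) (by simp)

lemma X1_pow_mul_X2_pow (a b : ℕ) : (X 1 ^ a * X 2 ^ b : MvPolynomial (Fin 3) ℂ) =
    monomial (Finsupp.single 1 a + Finsupp.single 2 b) 1 := by
  rw [X_pow_eq_monomial, X_pow_eq_monomial, monomial_mul, one_mul]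

lemma monomial_eq_pow_mul (m : Fin 3 →₀ ℕ) (c : ℂ) :
    monomial m c = C c * (X 0 ^ m 0 * (X 1 ^ m 1 * X 2 ^ m 2)) := by
  rw [monomial_eq, Finsupp.prod_fintype _ _ (by simp), Fin.prod_univ_three, mul_assoc]

lemma C_mul_mem_isobaric (c : ℂ) (hP : P ∈ isobaric n N) : C c * P ∈ isobaric n N := by
  rw [← smul_eq_C_mul]
  exact Submodule.smul_mem _ c hP

/-- Multiplying `∂P/∂X_i` by a form whose weight exceeds that of `X_i` by `c` raises the weight
by `c`. -/
lemma mul_pderiv_mem_isobaric {i : Fin 3} {c w M : ℕ} (hw : w = c + ![2, 4, 6] i)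
    (hQ : Q ∈ isobaric w M) (hP : P ∈ isobaric n N) :
    Q * pderiv i P ∈ isobaric (n + c) (N + M) := by
  classical
  intro m hm
  obtain ⟨a, ha, b, hb, rfl⟩ := Finset.mem_add.mp (support_mul _ _ hm)
  have h1 := hQ a ha
  have hb' : b + Finsupp.single i 1 ∈ P.support := by
    rw [mem_support_iff, coeff_pderiv] at hb
    exact mem_support_iff.mpr (left_ne_zero_of_mul hb)
  have h2 := hP _ hb'
  simp only [Finsupp.add_apply] at h2 ⊢
  fin_cases i <;> simp at h2 hw <;> omega

lemma X0_mul_pderiv_mem_isobaric (hP : P ∈ isobaric n N) : X 0 * pderiv 0 P ∈ isobaric n N := by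
  classical
  intro m hm
  obtain ⟨a, ha, b, hb, rfl⟩ := Finset.mem_add.mp (support_mul _ _ hm)
  rw [support_X, Finset.mem_singleton] at ha
  subst ha
  have hb' : b + Finsupp.single 0 1 ∈ P.support := by
    rw [mem_support_iff, coeff_pderiv] at hb
    exact mem_support_iff.mpr (left_ne_zero_of_mul hb)
  rw [add_comm (Finsupp.single 0 1) b]
  exact hP _ hb'

lemma pderiv_zero_mem_isobaric (hP : P ∈ isobaric (n + 2) (N + 1)) :
    pderiv 0 P ∈ isobaric n N := by
  intro b hb
  have hb' : b + Finsupp.single 0 1 ∈ P.support := by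
    rw [mem_support_iff, coeff_pderiv] at hb
    exact mem_support_iff.mpr (left_ne_zero_of_mul hb)
  have h2 := hP _ hb'
  simp at h2
  omega

lemma mem_isobaric_zero_of_pderiv_eq_zero (hP : P ∈ isobaric n N) (h : pderiv 0 P = 0) :
    P ∈ isobaric n 0 := by
  intro m hm
  refine ⟨(hP m hm).1, ?_⟩
  by_contra hm0
  have h1 := coeff_pderiv (i := 0) P (m - Finsupp.single 0 1)
  rw [tsub_add_cancel_of_le (by simpa using by omega), h, coeff_zero] at h1
  refine mul_ne_zero (mem_support_iff.mp hm) ?_ h1.symm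
  exact Nat.cast_add_one_ne_zero _

lemma pderiv_zero_eq_zero_of_mem (hP : P ∈ isobaric n 0) : pderiv 0 P = 0 := by
  ext b
  rw [coeff_pderiv, coeff_zero]
  by_cases hb : b + Finsupp.single 0 1 ∈ P.support
  · have := (hP _ hb).2
    simp at this
  · rw [notMem_support_iff.mp hb, zero_mul]

/-- Isobaric polynomials can be integrated with respect to `E_2`. -/
lemma exists_pderiv_zero_eq (hP : P ∈ isobaric n N) :
    ∃ Q ∈ isobaric (n + 2) (N + 1), pderiv 0 Q = P := by
  refine ⟨∑ m ∈ P.support, monomial (m + Finsupp.single 0 1) (coeff m P / (m 0 + 1)),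
    Submodule.sum_mem _ fun m hm ↦ monomial_mem_isobaric _ ?_ ?_, ?_⟩
  · have := hP m hm
    simp
    omega
  · have := hP m hm
    simp
    omega
  · conv_rhs => rw [P.as_sum]
    rw [map_sum]
    refine Finset.sum_congr rfl fun m _ ↦ ?_
    rw [pderiv_monomial]
    have : (m 0 + 1 : ℂ) ≠ 0 := Nat.cast_add_one_ne_zero _
    simp [div_mul_cancel₀ _ this]

lemma eval_three (x y z : ℂ) (P : MvPolynomial (Fin 3) ℂ) :
    eval ![x, y, z] P = ∑ m ∈ P.support, coeff m P * (x ^ m 0 * y ^ m 1 * z ^ m 2) := by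
  rw [eval_eq']
  simp [Fin.prod_univ_three]

lemma eval_scale (l x y z : ℂ) (hP : P ∈ isobaric n N) :
    eval ![l ^ 2 * x, l ^ 4 * y, l ^ 6 * z] P = l ^ n * eval ![x, y, z] P := by
  rw [eval_three, eval_three, Finset.mul_sum]
  refine Finset.sum_congr rfl fun m hm ↦ ?_
  rw [← (hP m hm).1]
  ring

/-- The coefficient of `E_2^k`, as a polynomial in `E_4` and `E_6`. -/
noncomputable def coeffE2 (P : MvPolynomial (Fin 3) ℂ) (k : ℕ) : MvPolynomial (Fin 3) ℂ :=
  ∑ m ∈ P.support with m 0 = k, C (coeff m P) * (X 1 ^ m 1 * X 2 ^ m 2)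

lemma coeffE2_mem (hP : P ∈ isobaric (n + 2 * k) N) : coeffE2 P k ∈ isobaric n 0 := by
  refine Submodule.sum_mem _ fun m hm ↦ C_mul_mem_isobaric _ ?_
  rw [X1_pow_mul_X2_pow]
  have := Finset.mem_filter.mp hm
  have h1 := hP m this.1
  refine monomial_mem_isobaric _ ?_ ?_ <;> simp
  omega

lemma coeffE2_eq_zero (hP : P ∈ isobaric n N) (hk : n < 2 * k) : coeffE2 P k = 0 := by
  refine Finset.sum_eq_zero fun m hm ↦ ?_
  have := Finset.mem_filter.mp hm
  have h1 := hP m this.1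
  omega

lemma eq_zero_of_coeffE2_eq_zero (h : ∀ k, coeffE2 P k = 0) : P = 0 := by
  have h1 : P = ∑ m ∈ P.support, X 0 ^ m 0 * (C (coeff m P) * (X 1 ^ m 1 * X 2 ^ m 2)) := by
    conv_lhs => rw [P.as_sum]
    exact Finset.sum_congr rfl fun m _ ↦ by rw [monomial_eq_pow_mul]; ring
  rw [h1, ← Finset.sum_fiberwise_of_maps_to (g := fun m ↦ m 0)
    (t := P.support.image fun m ↦ m 0) (fun m hm ↦ Finset.mem_image_of_mem _ hm)]
  refine Finset.sum_eq_zero fun k _ ↦ ?_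
  have := h k
  rw [coeffE2] at this
  rw [← mul_zero (X 0 ^ k), ← this, Finset.mul_sum]
  refine Finset.sum_congr rfl fun m hm ↦ ?_
  rw [(Finset.mem_filter.mp hm).2]

/-- If `x ↦ P (x, y, z)` has infinitely many zeros, all its coefficients vanish. -/
lemma eval_coeffE2_eq_zero {x y z : ℂ} {s : ℕ → ℂ} (hs : Function.Injective s)
    (h : ∀ i, eval ![s i, y, z] P = 0) (k : ℕ) : eval ![x, y, z] (coeffE2 P k) = 0 := by
  let p : Polynomial ℂ := ∑ m ∈ P.support,
    Polynomial.monomial (m 0) (coeff m P * (y ^ m 1 * z ^ m 2))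
  have hp : p = 0 := by
    refine Polynomial.eq_zero_of_infinite_isRoot p
      ((Set.infinite_range_of_injective hs).mono ?_)
    rintro _ ⟨i, rfl⟩
    have := h i
    rw [eval_three] at this
    simp only [p, Set.mem_ofPred_eq, Polynomial.IsRoot, Polynomial.eval_finsetSum,
      Polynomial.eval_monomial]
    rw [← this]
    exact Finset.sum_congr rfl fun m _ ↦ by ring
  have h2 : p.coeff k = 0 := by rw [hp, Polynomial.coeff_zero]
  simp only [p, Polynomial.finsetSum_coeff, Polynomial.coeff_monomial] at h2
  rw [← Finset.sum_filter] at h2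
  simpa [coeffE2] using h2

end Isobaric

/-! ### Modular transformation of an isobaric relation -/

section Transformation

open MvPolynomial EisensteinSeries
open UpperHalfPlane hiding I
open Complex ModularForm
open scoped Real

variable {n N : ℕ} {P : MvPolynomial (Fin 3) ℂ}

lemma evalE_nome (P : MvPolynomial (Fin 3) ℂ) (τ : ℍ) :
    evalE P (nome τ) = eval ![E2 τ, E₄ τ, E₆ τ] P := by
  rw [E2_eq_eisensteinQ, E4_eq_eisensteinQ, E6_eq_eisensteinQ, evalE]

lemma levelOne_apply_smul {k : ℕ} (f : ModularForm 𝒮ℒ k) (γ : SL(2, ℤ)) (τ : ℍ) :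
    f (γ • τ) = denom γ τ ^ k * f τ := by
  have h := congrFun (slash_invariant_levelOne f γ) τ
  rw [ModularForm.SL_slash_apply, zpow_neg, zpow_natCast] at h
  have := denom_ne_zero γ τ
  rw [← h]
  field_simp

lemma E2_apply_smul (γ : SL(2, ℤ)) (τ : ℍ) :
    E2 (γ • τ) = denom γ τ ^ 2 * (E2 τ + 12 * (2 * π * I)⁻¹ * (γ 1 0 / denom γ τ)) := by
  have h := E2_slash_apply γ τ
  rw [ModularForm.SL_slash_apply, zpow_neg] at h
  have := denom_ne_zero γ τ
  rw [← h, zpow_ofNat]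
  field_simp

/-- The matrices `(0, -1; 1, i)`, through which a relation at `τ` is moved to infinitely many
values of the variable `E_2`. -/
def inversionShift (i : ℕ) : SL(2, ℤ) := ⟨!![0, -1; 1, i], by simp⟩

lemma denom_inversionShift (i : ℕ) (τ : ℍ) : denom (inversionShift i) τ = τ + i := by
  rw [ModularGroup.denom_apply]
  simp [inversionShift]

/-- An isobaric relation between the Eisenstein series splits into relations between `E_4` and
`E_6`, because `E_2` is only quasi-modular. -/
lemma evalE_coeffE2_eq_zero (hP : P ∈ isobaric n N)
    (h : ∀ q : ℂ, q ≠ 0 → ‖q‖ < 1 → evalE P q = 0) (k : ℕ) {q : ℂ} (h0 : q ≠ 0) (hq : ‖q‖ < 1) :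
    evalE (coeffE2 P k) q = 0 := by
  obtain ⟨τ, rfl⟩ := exists_nome_eq h0 hq
  rw [evalE_nome]
  have hne (i : ℕ) : (τ : ℂ) + i ≠ 0 := by
    rw [← denom_inversionShift]
    exact denom_ne_zero _ _
  have hpi := two_pi_I_ne_zero
  refine eval_coeffE2_eq_zero
    (s := fun i : ℕ ↦ E2 τ + 12 * (2 * π * I)⁻¹ * (1 / ((τ : ℂ) + i))) ?_ ?_ k
  · intro i j hij
    have h1 : (1 : ℂ) / ((τ : ℂ) + i) = 1 / ((τ : ℂ) + j) := by
      have h2 : (12 * (2 * π * I)⁻¹ : ℂ) ≠ 0 := mul_ne_zero (by norm_num) (inv_ne_zero hpi)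
      exact mul_left_cancel₀ h2 (add_left_cancel hij)
    rw [one_div, one_div, inv_inj, add_right_inj] at h1
    exact_mod_cast h1
  · intro i
    have h1 := h (nome (inversionShift i • τ))
      (Function.Periodic.qParam_ne_zero _) (norm_nome_lt_one _)
    rw [evalE_nome, E2_apply_smul, levelOne_apply_smul (k := 4), levelOne_apply_smul (k := 6),
      denom_inversionShift, eval_scale _ _ _ _ hP] at h1
    have h2 := (mul_eq_zero.mp h1).resolve_left (pow_ne_zero _ (hne i))
    simpa [inversionShift] using h2

end Transformation

/-! ### Truncated Taylor expansions in a triangular basis -/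

section Triangular

open Asymptotics Filter

/-- An analytic function is congruent modulo `q^d` to a combination of the functions
`q^j u_j`, `j < d`, with `u_j(0) ≠ 0`. -/
lemma exists_sum_isBigO_pow {u : ℕ → ℂ → ℂ} (hu : ∀ j, AnalyticAt ℂ (u j) 0)
    (hu0 : ∀ j, u j 0 ≠ 0) {f : ℂ → ℂ} (hf : AnalyticAt ℂ f 0) (d : ℕ) :
    ∃ c : ℕ → ℂ, (fun q ↦ f q - ∑ j ∈ Finset.range d, c j * (q ^ j * u j q))
      =O[𝓝[≠] 0] fun q ↦ q ^ d := by
  suffices h : ∃ (c : ℕ → ℂ) (g : ℂ → ℂ), AnalyticAt ℂ g 0 ∧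
      ∀ q, f q - ∑ j ∈ Finset.range d, c j * (q ^ j * u j q) = q ^ d * g q by
    obtain ⟨c, g, hg, h⟩ := h
    refine ⟨c, ?_⟩
    simp only [h]
    simpa using (isBigO_refl (fun q : ℂ ↦ q ^ d) (𝓝[≠] 0)).mul
      ((hg.continuousAt.tendsto.isBigO_one ℂ).mono nhdsWithin_le_nhds)
  induction d with
  | zero => exact ⟨0, f, hf, fun q ↦ by simp⟩
  | succ d ih =>
    obtain ⟨c, g, hg, h⟩ := ih
    -- This choice of the `d`-th coefficient cancels the constant term of the remainder `g`.
    let r := g 0 / u d 0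
    let k : ℂ → ℂ := fun q ↦ g q - r * u d q
    have hk : AnalyticAt ℂ k 0 := hg.sub (analyticAt_const.mul (hu d))
    have hk0 : k 0 = 0 := by simp [k, r, div_mul_cancel₀ _ (hu0 d)]
    obtain ⟨p, hp⟩ := hk
    refine ⟨Function.update c d r, dslope k 0, ⟨_, hp.has_fpower_series_dslope_fslope⟩,
      fun q ↦ ?_⟩
    have h1 : k q = q * dslope k 0 q := by
      have := sub_smul_dslope k 0 q
      simpa [hk0] using this.symm
    rw [Finset.sum_range_succ, Finset.sum_congr rfl (g := fun j ↦ c j * (q ^ j * u j q))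
      (fun j hj ↦ by rw [Function.update_of_ne (Finset.mem_range.mp hj).ne]),
      Function.update_self]
    have h2 := h q
    simp only [k] at h1
    linear_combination h2 + q ^ d * h1

/-- A combination of `q^j u_j`, `j < d`, with `u_j(0) ≠ 0`, that is `O(q^d)` is trivial. -/
lemma eq_zero_of_sum_isBigO_pow {u : ℕ → ℂ → ℂ} (hu : ∀ j, AnalyticAt ℂ (u j) 0)
    (hu0 : ∀ j, u j 0 ≠ 0) (c : ℕ → ℂ) (d : ℕ)
    (h : (fun q ↦ ∑ j ∈ Finset.range d, c j * (q ^ j * u j q)) =O[𝓝[≠] 0] fun q ↦ q ^ d) :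
    ∀ j < d, c j = 0 := by
  induction d with
  | zero => simp
  | succ d ih =>
    have hq : Tendsto (fun q : ℂ ↦ q) (𝓝[≠] 0) (𝓝 0) := nhdsWithin_le_nhds
    have hlast : (fun q ↦ c d * (q ^ d * u d q)) =O[𝓝[≠] 0] fun q ↦ q ^ d := by
      have h1 := (isBigO_refl (fun q : ℂ ↦ q ^ d) (𝓝[≠] 0)).mul
        (((hu d).continuousAt.tendsto.isBigO_one ℂ).mono nhdsWithin_le_nhds)
      simpa using h1.const_mul_left (c d)
    have hlt : (fun q : ℂ ↦ q ^ (d + 1)) =O[𝓝[≠] 0] fun q ↦ q ^ d := by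
      simpa [pow_succ] using (isBigO_refl (fun q : ℂ ↦ q ^ d) (𝓝[≠] 0)).mul (hq.isBigO_one ℂ)
    have hc : ∀ j < d, c j = 0 := ih (by
      refine ((h.trans hlt).sub hlast).congr_left fun q ↦ ?_
      rw [Finset.sum_range_succ, add_sub_cancel_right])
    have h2 : (fun q ↦ c d * u d q) =O[𝓝[≠] 0] fun q : ℂ ↦ q := by
      have h3 := (isBigO_refl (fun q : ℂ ↦ (q ^ d)⁻¹) (𝓝[≠] 0)).mul h
      refine h3.congr' ?_ ?_ <;> filter_upwards [self_mem_nhdsWithin] with q hq0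
      · have : q ^ d ≠ 0 := pow_ne_zero _ hq0
        rw [Finset.sum_range_succ, Finset.sum_eq_zero fun j hj ↦ by
          rw [hc j (Finset.mem_range.mp hj), zero_mul]]
        field_simp
        ring
      · have : q ^ d ≠ 0 := pow_ne_zero _ hq0
        rw [pow_succ]
        field_simp
    have h4 : c d * u d 0 = 0 := tendsto_nhds_unique
      (((continuousAt_const.mul (hu d).continuousAt).tendsto).mono_left nhdsWithin_le_nhds)
      (h2.trans_tendsto hq)
    intro j hj
    rcases Nat.lt_succ_iff_lt_or_eq.mp hj with h | rfl
    · exact hc j h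
    · exact (mul_eq_zero.mp h4).resolve_right (hu0 j)

end Triangular

/-! ### Forms in `E_4`, `E_6` and their leading Taylor coefficients -/

section LeadingCoefficients

open MvPolynomial Asymptotics Filter

/-- The discriminant `(E_4³ - E_6²) / 1728` as a polynomial. -/
noncomputable def deltaPoly : MvPolynomial (Fin 3) ℂ := C (1 / 1728) * (X 1 ^ 3 - X 2 ^ 2)

/-- The number of pairs `(j, a)` with `12j + 4a + 6b = n`, where `b ∈ {0, 1}` is determined by
`2b ≡ n mod 4`; for even `n` this is the dimension of the space of level one modular forms of
weight `n`. -/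
def modularDim (n : ℕ) : ℕ := (n + 12 - 6 * (n / 2 % 2)) / 12

/-- The form `Δ^j E_4^a E_6^b` of even weight `n`, with `b ≤ 1`. -/
noncomputable def triangularForm (n j : ℕ) : MvPolynomial (Fin 3) ℂ :=
  deltaPoly ^ j * (X 1 ^ ((n - 6 * (n / 2 % 2) - 12 * j) / 4) * X 2 ^ (n / 2 % 2))

lemma deltaPoly_mul_triangularForm (n j : ℕ) :
    deltaPoly * triangularForm n j = triangularForm (n + 12) (j + 1) := by
  rw [triangularForm, triangularForm, show (n + 12) / 2 % 2 = n / 2 % 2 by omega,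
    show n + 12 - 6 * (n / 2 % 2) - 12 * (j + 1) = n - 6 * (n / 2 % 2) - 12 * j by omega]
  ring

lemma deltaPoly_mem_isobaric : deltaPoly ∈ isobaric 12 0 := by
  refine C_mul_mem_isobaric _ (Submodule.sub_mem _ ?_ ?_)
  · rw [X_pow_eq_monomial]
    exact monomial_mem_isobaric _ (by simp) (by simp)
  · rw [X_pow_eq_monomial]
    exact monomial_mem_isobaric _ (by simp) (by simp)

lemma X1_pow_mul_X2_pow_mem (a b : ℕ) :
    (X 1 ^ a * X 2 ^ b : MvPolynomial (Fin 3) ℂ) ∈ isobaric (4 * a + 6 * b) 0 := by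
  rw [X1_pow_mul_X2_pow]
  exact monomial_mem_isobaric _ (by simp) (by simp)

lemma triangularForm_mem_isobaric {n j : ℕ} (hn : Even n) (hj : j < modularDim n) :
    triangularForm n j ∈ isobaric n 0 := by
  have h1 : deltaPoly ^ j ∈ isobaric (12 * j) 0 := by
    induction j with
    | zero => exact monomial_mem_isobaric (m := 0) 1 (by simp) (by simp)
    | succ j ih =>
      simpa [pow_succ, mul_add] using isobaric_mul (ih (by omega)) deltaPoly_mem_isobaric
  have h2 := isobaric_mul h1 (X1_pow_mul_X2_pow_mem ((n - 6 * (n / 2 % 2) - 12 * j) / 4) (n / 2 % 2))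
  have h3 : 12 * j + (4 * ((n - 6 * (n / 2 % 2) - 12 * j) / 4) + 6 * (n / 2 % 2)) = n := by
    obtain ⟨m, rfl⟩ := hn
    unfold modularDim at hj
    omega
  rwa [h3] at h2

/-- Replacing `E_6²` by `E_4³ - 1728 Δ` writes each monomial in the triangular basis. -/
lemma X1_pow_mul_X2_pow_mem_span (b : ℕ) : ∀ a : ℕ,
    (X 1 ^ a * X 2 ^ b : MvPolynomial (Fin 3) ℂ) ∈ Submodule.span ℂ
      (triangularForm (4 * a + 6 * b) '' Set.Iio (modularDim (4 * a + 6 * b))) := by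
  induction b using Nat.strong_induction_on with | _ b ih =>
  intro a
  rcases lt_or_ge b 2 with hb | hb
  · refine Submodule.subset_span ⟨0, ?_, ?_⟩
    · rw [Set.mem_Iio, modularDim, show (4 * a + 6 * b) / 2 % 2 = b by omega]
      omega
    · rw [triangularForm, show (4 * a + 6 * b) / 2 % 2 = b by omega,
        show (4 * a + 6 * b - 6 * b - 12 * 0) / 4 = a by omega, pow_zero, one_mul]
  · obtain ⟨b, rfl⟩ := Nat.exists_eq_add_of_le' hb
    have h1 := ih b (by omega) (a + 3)
    have h2 := ih b (by omega) a
    rw [show 4 * (a + 3) + 6 * b = 4 * a + 6 * (b + 2) by omega] at h1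
    have h3 : deltaPoly * (X 1 ^ a * X 2 ^ b) ∈ Submodule.span ℂ
        (triangularForm (4 * a + 6 * (b + 2)) '' Set.Iio (modularDim (4 * a + 6 * (b + 2)))) := by
      have h4 := Submodule.mem_map_of_mem (f := LinearMap.mulLeft ℂ deltaPoly) h2
      rw [Submodule.map_span] at h4
      refine Submodule.span_mono ?_ h4
      rintro _ ⟨_, ⟨j, hj, rfl⟩, rfl⟩
      refine ⟨j + 1, ?_, ?_⟩
      · simp only [Set.mem_Iio, modularDim] at hj ⊢
        omega
      · rw [show 4 * a + 6 * (b + 2) = 4 * a + 6 * b + 12 by ring, ← deltaPoly_mul_triangularForm]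
        rfl
    have h5 : (X 1 ^ a * X 2 ^ (b + 2) : MvPolynomial (Fin 3) ℂ)
        = X 1 ^ (a + 3) * X 2 ^ b - (1728 : ℂ) • (deltaPoly * (X 1 ^ a * X 2 ^ b)) := by
      have h6 : (C 1728 * C (1 / 1728) : MvPolynomial (Fin 3) ℂ) = 1 := by
        rw [← C_mul, ← C_1]
        norm_num
      rw [smul_eq_C_mul, deltaPoly]
      linear_combination (X 1 ^ 3 - X 2 ^ 2) * (X 1 ^ a * X 2 ^ b) * h6
    rw [h5]
    exact Submodule.sub_mem _ h1 (Submodule.smul_mem _ _ h3)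

lemma exists_eq_sum_triangularForm {n : ℕ} {P : MvPolynomial (Fin 3) ℂ} (hP : P ∈ isobaric n 0) :
    ∃ c : ℕ → ℂ, P = ∑ j ∈ Finset.range (modularDim n), C (c j) * triangularForm n j := by
  have h : P ∈ Submodule.span ℂ (triangularForm n '' Set.Iio (modularDim n)) := by
    rw [P.as_sum]
    refine Submodule.sum_mem _ fun m hm ↦ ?_
    have h1 := hP m hm
    rw [monomial_eq_pow_mul, ← smul_eq_C_mul, show m 0 = 0 by omega, pow_zero, one_mul,
      show n = 4 * m 1 + 6 * m 2 by omega]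
    exact Submodule.smul_mem _ _ (X1_pow_mul_X2_pow_mem_span _ _)
  rw [← Finset.coe_Iio, Submodule.mem_span_image_finset_iff_exists_fun] at h
  obtain ⟨c, hc⟩ := h
  refine ⟨fun j ↦ if h : j ∈ Finset.Iio (modularDim n) then c ⟨j, h⟩ else 0, ?_⟩
  rw [← hc, ← Nat.Iio_eq_range]
  refine Eq.trans ?_ (Finset.sum_coe_sort (Finset.Iio (modularDim n)) _)
  exact Finset.sum_congr rfl fun j _ ↦ by
    rw [smul_eq_C_mul]
    simp only [dif_pos j.2]

/-- The unit `u_j` in `triangularForm n j = q^j u_j(q)`. -/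
noncomputable def triangularUnit (n j : ℕ) (q : ℂ) : ℂ :=
  eulerProd q ^ j * (eisensteinQ 2 q ^ ((n - 6 * (n / 2 % 2) - 12 * j) / 4) *
    eisensteinQ 3 q ^ (n / 2 % 2))

lemma analyticAt_triangularUnit (n j : ℕ) : AnalyticAt ℂ (triangularUnit n j) 0 :=
  (analyticAt_eulerProd_zero.pow _).mul (((analyticAt_eisensteinQ 2 (by simp)).pow _).mul
    ((analyticAt_eisensteinQ 3 (by simp)).pow _))

lemma triangularUnit_zero (n j : ℕ) : triangularUnit n j 0 = 1 := by
  simp [triangularUnit, eulerProd_zero, eisensteinQ_zero]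

lemma evalE_triangularForm (n j : ℕ) {q : ℂ} (hq : ‖q‖ < 1) :
    evalE (triangularForm n j) q = q ^ j * triangularUnit n j q := by
  have h : evalE deltaPoly q = q * eulerProd q := by
    rw [← deltaQ_eq_mul_eulerProd]
    have := eisensteinQ_cube_sub_sq hq
    simp [evalE, deltaPoly, this]
  rw [triangularForm, triangularUnit]
  simp only [evalE, map_mul, map_pow] at h ⊢
  rw [h]
  simp
  ring

lemma eventually_norm_lt_one : ∀ᶠ q : ℂ in 𝓝[≠] 0, ‖q‖ < 1 :=
  nhdsWithin_le_nhds (by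
    filter_upwards [Metric.ball_mem_nhds (0 : ℂ) one_pos] with q hq using by simpa using hq)

/-- A form in `E_4`, `E_6` of weight `n` is determined by its first `modularDim n` Taylor
coefficients. -/
lemma eq_zero_of_evalE_isBigO {n : ℕ} {P : MvPolynomial (Fin 3) ℂ} (hP : P ∈ isobaric n 0)
    (h : evalE P =O[𝓝[≠] 0] fun q ↦ q ^ modularDim n) : P = 0 := by
  obtain ⟨c, rfl⟩ := exists_eq_sum_triangularForm hP
  have hc := eq_zero_of_sum_isBigO_pow (analyticAt_triangularUnit n)
    (fun j ↦ by simp [triangularUnit_zero]) c (modularDim n) (h.congr' (by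
      filter_upwards [eventually_norm_lt_one] with q hq
      simp only [← evalE_triangularForm n _ hq]
      simp [evalE]) EventuallyEq.rfl)
  exact Finset.sum_eq_zero fun j hj ↦ by rw [hc j (Finset.mem_range.mp hj), C_0, zero_mul]

/-- The first `modularDim n` Taylor coefficients of a form in `E_4`, `E_6` of even weight `n` can
be prescribed. -/
lemma exists_evalE_isBigO {n : ℕ} (hn : Even n) {f : ℂ → ℂ} (hf : AnalyticAt ℂ f 0) :
    ∃ P ∈ isobaric n 0, (fun q ↦ f q - evalE P q) =O[𝓝[≠] 0] fun q ↦ q ^ modularDim n := by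
  obtain ⟨c, hc⟩ := exists_sum_isBigO_pow (analyticAt_triangularUnit n)
    (fun j ↦ by simp [triangularUnit_zero]) hf (modularDim n)
  refine ⟨∑ j ∈ Finset.range (modularDim n), C (c j) * triangularForm n j,
    Submodule.sum_mem _ fun j hj ↦
      C_mul_mem_isobaric _ (triangularForm_mem_isobaric hn (Finset.mem_range.mp hj)),
    hc.congr' ?_ EventuallyEq.rfl⟩
  filter_upwards [eventually_norm_lt_one] with q hq
  simp only [← evalE_triangularForm n _ hq]
  simp [evalE]

/-- An isobaric polynomial is determined by its values on the Eisenstein series. -/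
lemma isobaric_eq_zero_of_evalE {n N : ℕ} {P : MvPolynomial (Fin 3) ℂ} (hP : P ∈ isobaric n N)
    (h : ∀ q : ℂ, q ≠ 0 → ‖q‖ < 1 → evalE P q = 0) : P = 0 := by
  refine eq_zero_of_coeffE2_eq_zero fun k ↦ ?_
  rcases lt_or_ge n (2 * k) with hk | hk
  · exact coeffE2_eq_zero hP hk
  · obtain ⟨n, rfl⟩ := Nat.exists_eq_add_of_le' hk
    refine eq_zero_of_evalE_isBigO (coeffE2_mem hP) ((isBigO_zero _ _).congr' ?_ EventuallyEq.rfl)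
    filter_upwards [eventually_norm_lt_one, self_mem_nhdsWithin] with q hq h0
    exact (evalE_coeffE2_eq_zero hP h k h0 hq).symm

lemma gapOrder_eq {g : ℕ} (hg : 1 ≤ g) : gapOrder g = modularDim (14 * (g - 1)) := by
  have h1 : (14 * ((g : ℤ) - 1)) = ((14 * (g - 1) : ℕ) : ℤ) := by push_cast [hg]; ring
  have h2 := ModularForm.dimension_level_one (14 * (g - 1)) ⟨7 * (g - 1), by ring⟩
  rw [gapOrder, h1]
  have h3 : Module.rank ℂ (ModularForm 𝒮ℒ ((14 * (g - 1) : ℕ) : ℤ))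
      = ((modularDim (14 * (g - 1)) : ℕ) : Cardinal) := by
    rw [h2]
    by_cases h : 14 * (g - 1) ≡ 2 [MOD 12]
    · rw [if_pos h]
      congr 1
      unfold modularDim
      unfold Nat.ModEq at h
      omega
    · rw [if_neg h]
      congr 1
      unfold modularDim
      unfold Nat.ModEq at h
      omega
  exact Module.finrank_eq_of_rank_eq h3

end LeadingCoefficients

/-! ### The derivative with respect to `ν` at fixed `t` -/

section NuDerivative

open MvPolynomial Filter

lemma isOpen_paramDomain : IsOpen paramDomain := by
  have h1 : IsOpen {p : ℂ × ℂ | 0 < ‖p.1‖} := isOpen_lt continuous_const (by fun_prop)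
  have h2 : IsOpen {p : ℂ × ℂ | ‖p.1‖ < 1} := isOpen_lt (by fun_prop) continuous_const
  have h3 : IsOpen {p : ℂ × ℂ | p.2 ≠ 0} := isOpen_ne_fun continuous_snd continuous_const
  exact h1.inter (h2.inter h3)

/-- The tangent vector `∂/∂ν = (ξ/E_4) (E_4 q ∂/∂q + (E_2 E_4 - E_6)/12 · ω_A ∂/∂ω_A)`. -/
noncomputable def nuVector (p : ℂ × ℂ) : ℂ × ℂ :=
  (xiOverE4 p * eisensteinQ 2 p.1 * p.1,
    xiOverE4 p * ((eisensteinQ 1 p.1 * eisensteinQ 2 p.1 - eisensteinQ 3 p.1) / 12) * p.2)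

/-- `F` is differentiable at `p` and its derivative along `∂/∂ν` is `d`. -/
def HasNuDeriv (F : ℂ × ℂ → ℂ) (d : ℂ) (p : ℂ × ℂ) : Prop :=
  ∃ F' : ℂ × ℂ →L[ℂ] ℂ, HasFDerivAt F F' p ∧ F' (nuVector p) = d

namespace HasNuDeriv

variable {F G : ℂ × ℂ → ℂ} {d e : ℂ} {p : ℂ × ℂ}

lemma congr_of_eventuallyEq (h : HasNuDeriv F d p) (hG : G =ᶠ[𝓝 p] F) : HasNuDeriv G d p :=
  let ⟨F', hF, hd⟩ := h
  ⟨F', hF.congr_of_eventuallyEq hG, hd⟩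

lemma add (hF : HasNuDeriv F d p) (hG : HasNuDeriv G e p) :
    HasNuDeriv (fun x ↦ F x + G x) (d + e) p := by
  obtain ⟨F', hF, rfl⟩ := hF
  obtain ⟨G', hG, rfl⟩ := hG
  exact ⟨_, hF.add hG, by simp⟩

lemma add_const (hF : HasNuDeriv F d p) (c : ℂ) : HasNuDeriv (fun x ↦ F x + c) d p := by
  obtain ⟨F', hF, rfl⟩ := hF
  exact ⟨_, hF.add_const c, rfl⟩

lemma const_mul (hF : HasNuDeriv F d p) (c : ℂ) : HasNuDeriv (fun x ↦ c * F x) (c * d) p := by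
  obtain ⟨F', hF, rfl⟩ := hF
  exact ⟨_, hF.const_mul c, by simp⟩

lemma mul (hF : HasNuDeriv F d p) (hG : HasNuDeriv G e p) :
    HasNuDeriv (fun x ↦ F x * G x) (d * G p + F p * e) p := by
  obtain ⟨F', hF, rfl⟩ := hF
  obtain ⟨G', hG, rfl⟩ := hG
  exact ⟨_, hF.mul hG, by simp; ring⟩

lemma pow (hF : HasNuDeriv F d p) (n : ℕ) :
    HasNuDeriv (fun x ↦ F x ^ n) (n * F p ^ (n - 1) * d) p := by
  obtain ⟨F', hF, rfl⟩ := hF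
  exact ⟨_, (hasDerivAt_pow n (F p)).comp_hasFDerivAt p hF, by simp⟩

end HasNuDeriv

lemma hasNuDeriv_comp_fst {f : ℂ → ℂ} {p : ℂ × ℂ} (hf : DifferentiableAt ℂ f p.1) :
    HasNuDeriv (fun x ↦ f x.1) (xiOverE4 p * eisensteinQ 2 p.1 * (p.1 * deriv f p.1)) p :=
  ⟨_, hf.hasDerivAt.comp_hasFDerivAt p hasFDerivAt_fst, by simp [nuVector]; ring⟩

lemma hasNuDeriv_snd_zpow {p : ℂ × ℂ} (hp : p.2 ≠ 0) (k : ℤ) :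
    HasNuDeriv (fun x ↦ x.2 ^ k) (xiOverE4 p *
      ((eisensteinQ 1 p.1 * eisensteinQ 2 p.1 - eisensteinQ 3 p.1) / 12) * (k * p.2 ^ k)) p :=
  ⟨_, (hasDerivAt_zpow k p.2 (Or.inl hp)).comp_hasFDerivAt p hasFDerivAt_snd, by
    have : p.2 ^ k = p.2 ^ (k - 1) * p.2 := by rw [← zpow_add_one₀ hp, sub_add_cancel]
    rw [this]
    simp [nuVector]
    ring⟩

lemma tParam_eq (p : ℂ × ℂ) :
    tParam p = (-(2 * (Real.pi : ℂ) ^ 4 / 3)) * (eisensteinQ 2 p.1 * p.2 ^ (-4 : ℤ)) := by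
  rw [tParam, zpow_neg, zpow_ofNat]
  ring

lemma nuParam_eq (p : ℂ × ℂ) :
    nuParam p = ((2 * (Real.pi : ℂ) * Complex.I) ^ 5 / 360) *
      ((eisensteinQ 3 p.1 - eisensteinQ 1 p.1 * eisensteinQ 2 p.1) * p.2 ^ (-5 : ℤ)) := by
  rw [nuParam, zpow_neg, zpow_ofNat, div_pow]
  ring

lemma xiOverE4_eq (p : ℂ × ℂ) :
    xiOverE4 p = (-(1 / (2 * (2 * (Real.pi : ℂ) * Complex.I) ^ 5))) *
      ((deltaQ p.1)⁻¹ * p.2 ^ (5 : ℤ)) := by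
  rw [xiOverE4, zpow_ofNat, div_pow, one_div, mul_inv, one_div, mul_inv]
  ring

lemma xiOverE4_ne_zero {p : ℂ × ℂ} (hp : p ∈ paramDomain) : xiOverE4 p ≠ 0 := by
  obtain ⟨h0, h1, h2⟩ := hp
  have hpi := Complex.two_pi_I_ne_zero
  have hd := deltaQ_ne_zero (norm_pos_iff.mp h0) h1
  rw [xiOverE4_eq]
  have : p.2 ^ (5 : ℤ) ≠ 0 := zpow_ne_zero _ h2
  simp [hd, h2, Real.pi_ne_zero]

lemma mul_deriv_nuNumerator {q : ℂ} (hq : ‖q‖ < 1) :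
    DifferentiableAt ℂ (fun q ↦ eisensteinQ 3 q - eisensteinQ 1 q * eisensteinQ 2 q) q ∧
    q * deriv (fun q ↦ eisensteinQ 3 q - eisensteinQ 1 q * eisensteinQ 2 q) q =
      5 / 6 * eisensteinQ 1 q * eisensteinQ 3 q - 5 / 12 * eisensteinQ 2 q ^ 2
        - 5 / 12 * eisensteinQ 1 q ^ 2 * eisensteinQ 2 q := by
  have h1 := (analyticAt_eisensteinQ 1 hq).differentiableAt
  have h2 := (analyticAt_eisensteinQ 2 hq).differentiableAt
  have h3 := (analyticAt_eisensteinQ 3 hq).differentiableAt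
  refine ⟨h3.sub (h1.mul h2), ?_⟩
  rw [(h3.hasDerivAt.fun_sub (h1.hasDerivAt.fun_mul h2.hasDerivAt)).deriv]
  linear_combination mul_deriv_eisensteinQ_three hq - eisensteinQ 2 q * mul_deriv_eisensteinQ_one hq
    - eisensteinQ 1 q * mul_deriv_eisensteinQ_two hq

lemma hasNuDeriv_tParam {p : ℂ × ℂ} (hp : p ∈ paramDomain) : HasNuDeriv tParam 0 p := by
  obtain ⟨h0, h1, h2⟩ := hp
  have h := ((hasNuDeriv_comp_fst (analyticAt_eisensteinQ 2 h1).differentiableAt).mul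
    (hasNuDeriv_snd_zpow h2 (-4))).const_mul (-(2 * (Real.pi : ℂ) ^ 4 / 3))
  simp only [← tParam_eq] at h
  convert h using 1
  rw [mul_deriv_eisensteinQ_two h1]
  push_cast
  ring

lemma hasNuDeriv_nuParam {p : ℂ × ℂ} (hp : p ∈ paramDomain) : HasNuDeriv nuParam 1 p := by
  obtain ⟨h0, h1, h2⟩ := hp
  have h := ((hasNuDeriv_comp_fst (mul_deriv_nuNumerator h1).1).mul
    (hasNuDeriv_snd_zpow h2 (-5))).const_mul ((2 * (Real.pi : ℂ) * Complex.I) ^ 5 / 360)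
  simp only [← nuParam_eq] at h
  convert h using 1
  have hd := deltaQ_ne_zero (norm_pos_iff.mp h0) h1
  have hpi := Complex.two_pi_I_ne_zero
  have hE := eisensteinQ_cube_sub_sq h1
  -- `E_4 D(E_6 - E_2 E_4) + (5/12) (E_2 E_4 - E_6)²` is `(5/12) (E_6² - E_4³) = -720 Δ`.
  have hX : (2 * (Real.pi : ℂ) * Complex.I) ^ 5 / 360 * (xiOverE4 p * p.2 ^ (-5 : ℤ)) =
      -(1 / (720 * deltaQ p.1)) := by
    rw [xiOverE4, div_pow, zpow_neg, zpow_ofNat]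
    generalize 2 * (Real.pi : ℂ) * Complex.I = c at *
    field_simp
    norm_num
  have hone : (1 : ℂ) = -(1 / (720 * deltaQ p.1)) * (-(720 * deltaQ p.1)) := by field_simp
  rw [(mul_deriv_nuNumerator h1).2, hone, ← hX]
  push_cast
  linear_combination (2 * (Real.pi : ℂ) * Complex.I) ^ 5 / 360 * (xiOverE4 p * p.2 ^ (-5 : ℤ)) *
    (5 / 12) * hE

lemma hasFDerivAt_mul_snd_zpow {f : ℂ → ℂ} {p : ℂ × ℂ} (hf : DifferentiableAt ℂ f p.1)
    (hp : p.2 ≠ 0) (c : ℂ) (k : ℤ) :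
    HasFDerivAt (fun x : ℂ × ℂ ↦ c * (f x.1 * x.2 ^ k))
      ((c * (deriv f p.1 * p.2 ^ k)) • ContinuousLinearMap.fst ℂ ℂ ℂ +
        (c * (f p.1 * (k * (p.2 ^ k * p.2⁻¹)))) • ContinuousLinearMap.snd ℂ ℂ ℂ) p := by
  have h := ((hf.hasDerivAt.comp_hasFDerivAt p hasFDerivAt_fst).mul
    ((hasDerivAt_zpow k p.2 (Or.inl hp)).comp_hasFDerivAt p
      (hasFDerivAt_snd (𝕜 := ℂ) (E := ℂ) (F := ℂ)))).const_mul c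
  rw [zpow_sub_one₀ hp] at h
  convert! h using 1
  ext
  · simp [mul_comm]
  · simp

/-- The Jacobian of `(t, ν)` is a nonvanishing multiple of `Δ`, so that `(t, ν)` are local
coordinates. -/
lemma fderiv_tNu_injective {p : ℂ × ℂ} (hp : p ∈ paramDomain) :
    Function.Injective (fderiv ℂ tNu p) := by
  obtain ⟨h0, h1, h2⟩ := hp
  have hd := deltaQ_ne_zero (norm_pos_iff.mp h0) h1
  have hpi := Complex.two_pi_I_ne_zero
  have hπ : (Real.pi : ℂ) ≠ 0 := by exact_mod_cast Real.pi_ne_zero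
  have hq := norm_pos_iff.mp h0
  have hE := eisensteinQ_cube_sub_sq h1
  have ht := hasFDerivAt_mul_snd_zpow (analyticAt_eisensteinQ 2 h1).differentiableAt h2
    (-(2 * (Real.pi : ℂ) ^ 4 / 3)) (-4)
  have hν := hasFDerivAt_mul_snd_zpow (mul_deriv_nuNumerator h1).1 h2
    ((2 * (Real.pi : ℂ) * Complex.I) ^ 5 / 360) (-5)
  simp only [← tParam_eq] at ht
  simp only [← nuParam_eq] at hν
  rw [HasFDerivAt.fderiv (f := tNu) (ht.prodMk hν), injective_iff_map_eq_zero]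
  rintro ⟨a, b⟩ hab
  have e4 := mul_deriv_eisensteinQ_two h1
  have e5 := (mul_deriv_nuNumerator h1).2
  have hn4 : p.2 ^ (-4 : ℤ) ≠ 0 := zpow_ne_zero _ h2
  have hn5 : p.2 ^ (-5 : ℤ) ≠ 0 := zpow_ne_zero _ h2
  have hab1 : (-(2 * (Real.pi : ℂ) ^ 4 / 3)) * (deriv (eisensteinQ 2) p.1 * p.2 ^ (-4 : ℤ)) * a +
      (-(2 * (Real.pi : ℂ) ^ 4 / 3)) *
        (eisensteinQ 2 p.1 * (((-4 : ℤ) : ℂ) * (p.2 ^ (-4 : ℤ) * p.2⁻¹))) * b = 0 :=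
    congrArg Prod.fst hab
  have hab2 := congrArg Prod.snd hab
  have hc4 : (-(2 * (Real.pi : ℂ) ^ 4 / 3)) * p.2 ^ (-4 : ℤ) ≠ 0 := by
    refine mul_ne_zero (neg_ne_zero.mpr (div_ne_zero ?_ (by norm_num))) hn4
    exact mul_ne_zero two_ne_zero (pow_ne_zero _ hπ)
  have hc5 : (2 * (Real.pi : ℂ) * Complex.I) ^ 5 / 360 * p.2 ^ (-5 : ℤ) ≠ 0 :=
    mul_ne_zero (div_ne_zero (pow_ne_zero _ hpi) (by norm_num)) hn5
  set f := fun q ↦ eisensteinQ 3 q - eisensteinQ 1 q * eisensteinQ 2 q with hf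
  replace hab2 : (2 * (Real.pi : ℂ) * Complex.I) ^ 5 / 360 * (deriv f p.1 * p.2 ^ (-5 : ℤ)) * a +
      (2 * (Real.pi : ℂ) * Complex.I) ^ 5 / 360 *
        (f p.1 * (((-5 : ℤ) : ℂ) * (p.2 ^ (-5 : ℤ) * p.2⁻¹))) * b = 0 := hab2
  set w := p.2⁻¹ * b with hw
  have k1 : deriv (eisensteinQ 2) p.1 * a - 4 * eisensteinQ 2 p.1 * w = 0 :=
    mul_left_cancel₀ hc4 (by rw [hw]; push_cast at hab1; linear_combination hab1)
  have k2 : deriv f p.1 * a - 5 * f p.1 * w = 0 :=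
    mul_left_cancel₀ hc5 (by rw [hw]; push_cast at hab2; linear_combination hab2)
  have hfp : f p.1 = eisensteinQ 3 p.1 - eisensteinQ 1 p.1 * eisensteinQ 2 p.1 := rfl
  -- Eliminating the second component leaves the determinant, `-2880 Δ` up to nonzero factors.
  have ha : a = 0 := by
    have : (-(2880 * deltaQ p.1)) * a = 0 := by
      rw [hfp] at k2
      linear_combination p.1 * (-5 * (eisensteinQ 3 p.1 - eisensteinQ 1 p.1 * eisensteinQ 2 p.1) * k1
        + 4 * eisensteinQ 2 p.1 * k2) + a * (5 * (eisensteinQ 3 p.1 - eisensteinQ 1 p.1 *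
        eisensteinQ 2 p.1) * e4 - 4 * eisensteinQ 2 p.1 * e5) + a * (5 / 3) * hE
    exact (mul_eq_zero.mp this).resolve_left (neg_ne_zero.mpr (mul_ne_zero (by norm_num) hd))
  have hw0 : w = 0 := by
    by_contra hne
    rw [ha] at k1 k2
    have z4 : eisensteinQ 2 p.1 = 0 := by simpa [hne] using k1
    have z6 : f p.1 = 0 := by simpa [hne] using k2
    rw [hfp, z4, mul_zero, sub_zero] at z6
    rw [z4, z6] at hE
    exact hd (by simpa using hE.symm)
  have hb : b = 0 := (mul_eq_zero.mp hw0).resolve_left (inv_ne_zero h2)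
  rw [ha, hb]
  rfl

/-- The vector used in `dNu`, defined through the inverse of the Jacobian, is `nuVector`. -/
lemma dNu_eq {F : ℂ × ℂ → ℂ} {d : ℂ} {p : ℂ × ℂ} (hp : p ∈ paramDomain) (h : HasNuDeriv F d p) :
    dNu F p = d := by
  obtain ⟨F', hF, rfl⟩ := h
  obtain ⟨t', ht, ht'⟩ := hasNuDeriv_tParam hp
  obtain ⟨n', hn, hn'⟩ := hasNuDeriv_nuParam hp
  have hinj := fderiv_tNu_injective hp
  have hinv : (fderiv ℂ tNu p).IsInvertible :=
    ⟨(LinearEquiv.ofInjectiveEndo (fderiv ℂ tNu p : ℂ × ℂ →ₗ[ℂ] ℂ × ℂ) hinj).toContinuousLinearEquiv,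
      by ext <;> rfl⟩
  have hT : HasFDerivAt tNu (t'.prod n') p := ht.prodMk hn
  have hv : (fderiv ℂ tNu p).inverse (0, 1) = nuVector p := by
    rw [hinv.inverse_apply_eq, hT.fderiv]
    exact (Prod.ext ht' hn').symm
  rw [dNu, hv, hF.fderiv]

end NuDerivative

/-! ### `∂/∂ν` on quasi-modular free energies -/

section QuasiModularCalculus

open MvPolynomial Filter

/-- Ramanujan's derivation on polynomials in `E_2, E_4, E_6`, which represents `q d/dq`. -/
noncomputable def ramanujan (P : MvPolynomial (Fin 3) ℂ) : MvPolynomial (Fin 3) ℂ :=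
  C (1 / 12) * (X 0 * (X 0 * pderiv 0 P) - X 1 * pderiv 0 P) +
  C (1 / 3) * (X 0 * X 1 * pderiv 1 P - X 2 * pderiv 1 P) +
  C (1 / 2) * (X 0 * X 2 * pderiv 2 P - X 1 * X 1 * pderiv 2 P)

lemma ramanujan_mem_isobaric {n N : ℕ} {P : MvPolynomial (Fin 3) ℂ} (hP : P ∈ isobaric n N) :
    ramanujan P ∈ isobaric (n + 2) (N + 1) := by
  have h01 := isobaric_mul X0_mem_isobaric X1_mem_isobaric
  have h02 := isobaric_mul X0_mem_isobaric X2_mem_isobaric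
  have h11 := isobaric_mul X1_mem_isobaric X1_mem_isobaric
  have hX : X 0 * (X 0 * pderiv 0 P) ∈ isobaric (n + 2) (N + 1) := by
    rw [add_comm n, add_comm N]
    exact isobaric_mul X0_mem_isobaric (X0_mul_pderiv_mem_isobaric hP)
  refine Submodule.add_mem _ (Submodule.add_mem _ ?_ ?_) ?_ <;>
    refine C_mul_mem_isobaric _ (Submodule.sub_mem _ ?_ ?_)
  · exact hX
  · exact isobaric_mono (Nat.le_succ N) (mul_pderiv_mem_isobaric (by simp) X1_mem_isobaric hP)
  · exact mul_pderiv_mem_isobaric (by simp) h01 hP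
  · exact isobaric_mono (Nat.le_succ N) (mul_pderiv_mem_isobaric (by simp) X2_mem_isobaric hP)
  · exact mul_pderiv_mem_isobaric (by simp) h02 hP
  · exact isobaric_mono (Nat.le_succ N) (mul_pderiv_mem_isobaric (by simp) h11 hP)

lemma analyticAt_evalE (P : MvPolynomial (Fin 3) ℂ) {q : ℂ} (hq : ‖q‖ < 1) :
    AnalyticAt ℂ (evalE P) q := by
  induction P using MvPolynomial.induction_on with
  | C a => exact analyticAt_const.congr (.of_forall fun x ↦ by simp [evalE]; rfl)
  | add P Q hP hQ => exact (hP.add hQ).congr (.of_forall fun x ↦ by simp [evalE])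
  | mul_X P i hP =>
    have hi : AnalyticAt ℂ (evalE (X i)) q := by
      fin_cases i
      · exact (analyticAt_eisensteinQ 1 hq).congr (.of_forall fun x ↦ by simp [evalE])
      · exact (analyticAt_eisensteinQ 2 hq).congr (.of_forall fun x ↦ by simp [evalE])
      · exact (analyticAt_eisensteinQ 3 hq).congr (.of_forall fun x ↦ by simp [evalE])
    exact (hP.mul hi).congr (.of_forall fun x ↦ by simp [evalE])

lemma ramanujan_mul (P Q : MvPolynomial (Fin 3) ℂ) :
    ramanujan (P * Q) = ramanujan P * Q + P * ramanujan Q := by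
  simp only [ramanujan, pderiv_mul]
  ring

lemma mul_deriv_evalE (P : MvPolynomial (Fin 3) ℂ) {q : ℂ} (hq : ‖q‖ < 1) :
    q * deriv (evalE P) q = evalE (ramanujan P) q := by
  induction P using MvPolynomial.induction_on with
  | C a =>
    have h : evalE (C a) = fun _ ↦ a := by ext; simp [evalE]
    rw [h, deriv_const]
    simp [evalE, ramanujan]
  | add P Q hP hQ =>
    have h : evalE (P + Q) = fun x ↦ evalE P x + evalE Q x := by ext; simp [evalE]
    have hR : ramanujan (P + Q) = ramanujan P + ramanujan Q := by
      simp only [ramanujan, map_add]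
      ring
    rw [h, deriv_fun_add (analyticAt_evalE P hq).differentiableAt
      (analyticAt_evalE Q hq).differentiableAt, mul_add, hP, hQ, hR]
    simp [evalE]
  | mul_X P i hP =>
    have h : evalE (P * X i) = fun x ↦ evalE P x * evalE (X i) x := by ext; simp [evalE]
    have hi : q * deriv (evalE (X i)) q = evalE (ramanujan (X i)) q := by
      fin_cases i
      · have h : evalE (X 0) = eisensteinQ 1 := by ext; simp [evalE]
        change q * deriv (evalE (X 0)) q = evalE (ramanujan (X 0)) q
        rw [h, mul_deriv_eisensteinQ_one hq]
        simp [evalE, ramanujan, pderiv_X]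
        ring
      · have h : evalE (X 1) = eisensteinQ 2 := by ext; simp [evalE]
        change q * deriv (evalE (X 1)) q = evalE (ramanujan (X 1)) q
        rw [h, mul_deriv_eisensteinQ_two hq]
        simp [evalE, ramanujan, pderiv_X]
        ring
      · have h : evalE (X 2) = eisensteinQ 3 := by ext; simp [evalE]
        change q * deriv (evalE (X 2)) q = evalE (ramanujan (X 2)) q
        rw [h, mul_deriv_eisensteinQ_three hq]
        simp [evalE, ramanujan, pderiv_X]
        ring
    rw [h, deriv_fun_mul (analyticAt_evalE P hq).differentiableAt
      (analyticAt_evalE (X i) hq).differentiableAt, ramanujan_mul]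
    simp only [evalE, map_add, map_mul] at hP hi ⊢
    linear_combination (eval _ (X i)) * hP + (eval _ P) * hi

/-- The operator on polynomials representing `∂/∂ν` on `(ξ/E_4)^k P(E_2, E_4, E_6)`:
`∂/∂ν ((ξ/E_4)^k P) = (ξ/E_4)^{k+1} (nuDerivPoly k P)`. -/
noncomputable def nuDerivPoly (k : ℕ) (P : MvPolynomial (Fin 3) ℂ) : MvPolynomial (Fin 3) ℂ :=
  X 1 * ramanujan P - C ((k : ℂ) / 12) * ((C 7 * (X 0 * X 1) + C 5 * X 2) * P)

lemma nuDerivPoly_mem_isobaric {n N : ℕ} {P : MvPolynomial (Fin 3) ℂ} (k : ℕ)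
    (hP : P ∈ isobaric n N) : nuDerivPoly k P ∈ isobaric (n + 6) (N + 1) := by
  refine Submodule.sub_mem _ ?_ (C_mul_mem_isobaric _ ?_)
  · have := isobaric_mul X1_mem_isobaric (ramanujan_mem_isobaric hP)
    rwa [show 4 + (n + 2) = n + 6 by ring, zero_add] at this
  · have h1 : (C 7 * (X 0 * X 1) + C 5 * X 2 : MvPolynomial (Fin 3) ℂ) ∈ isobaric 6 1 :=
      Submodule.add_mem _ (C_mul_mem_isobaric _ (isobaric_mul X0_mem_isobaric X1_mem_isobaric))
        (C_mul_mem_isobaric _ (isobaric_mono zero_le_one X2_mem_isobaric))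
    rw [add_comm n, add_comm N]
    exact isobaric_mul h1 hP

lemma hasNuDeriv_xiOverE4 {p : ℂ × ℂ} (hp : p ∈ paramDomain) :
    HasNuDeriv xiOverE4 (-(xiOverE4 p ^ 2 *
      (7 * (eisensteinQ 1 p.1 * eisensteinQ 2 p.1) + 5 * eisensteinQ 3 p.1) / 12)) p := by
  obtain ⟨h0, h1, h2⟩ := hp
  have hd := deltaQ_ne_zero (norm_pos_iff.mp h0) h1
  have h := ((hasNuDeriv_comp_fst (f := fun q ↦ (deltaQ q)⁻¹)
    ((differentiableAt_deltaQ h1).inv hd)).mul (hasNuDeriv_snd_zpow h2 5)).const_mul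
      (-(1 / (2 * (2 * (Real.pi : ℂ) * Complex.I) ^ 5)))
  simp only [← xiOverE4_eq] at h
  convert h using 1
  have hD : p.1 * deriv (fun q ↦ (deltaQ q)⁻¹) p.1 = -(eisensteinQ 1 p.1 * (deltaQ p.1)⁻¹) := by
    rw [((differentiableAt_deltaQ h1).hasDerivAt.fun_inv hd).deriv]
    have := mul_deriv_deltaQ h1
    field_simp
    linear_combination -this
  rw [hD]
  have hX := xiOverE4_eq p
  push_cast
  linear_combination -(xiOverE4 p * (7 * (eisensteinQ 1 p.1 * eisensteinQ 2 p.1)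
    + 5 * eisensteinQ 3 p.1) / 12) * hX

lemma hasNuDeriv_xi_pow_mul_evalE {p : ℂ × ℂ} (hp : p ∈ paramDomain) (k : ℕ)
    (P : MvPolynomial (Fin 3) ℂ) :
    HasNuDeriv (fun x ↦ xiOverE4 x ^ k * evalE P x.1)
      (xiOverE4 p ^ (k + 1) * evalE (nuDerivPoly k P) p.1) p := by
  have h1 := ((hasNuDeriv_xiOverE4 hp).pow k).mul
    (hasNuDeriv_comp_fst (analyticAt_evalE P hp.2.1).differentiableAt)
  convert h1 using 1
  rw [mul_deriv_evalE P hp.2.1]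
  have h2 : evalE (nuDerivPoly k P) p.1 = eisensteinQ 2 p.1 * evalE (ramanujan P) p.1 -
      k / 12 * ((7 * (eisensteinQ 1 p.1 * eisensteinQ 2 p.1) + 5 * eisensteinQ 3 p.1)
        * evalE P p.1) := by
    simp [evalE, nuDerivPoly]
  rw [h2]
  rcases Nat.eq_zero_or_pos k with rfl | hk
  · simp
    ring
  · obtain ⟨k, rfl⟩ := Nat.exists_eq_add_of_le' hk
    simp only [Nat.add_sub_cancel]
    push_cast
    ring

lemma dNu_eventuallyEq {p : ℂ × ℂ} (hp : p ∈ paramDomain) {k : ℕ} {P : MvPolynomial (Fin 3) ℂ}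
    {F : ℂ × ℂ → ℂ} (hF : F =ᶠ[𝓝 p] fun x ↦ xiOverE4 x ^ k * evalE P x.1) :
    dNu F =ᶠ[𝓝 p] fun x ↦ xiOverE4 x ^ (k + 1) * evalE (nuDerivPoly k P) x.1 := by
  filter_upwards [hF.eventuallyEq_nhds, isOpen_paramDomain.mem_nhds hp] with x hx hxD
  exact dNu_eq hxD ((hasNuDeriv_xi_pow_mul_evalE hxD k P).congr_of_eventuallyEq hx)

end QuasiModularCalculus

/-! ### The free energy of genus one -/

section GenusOne

open MvPolynomial Filter

/-- Any continuous branch of `log h` has the derivative of `log h` along `∂/∂ν`. -/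
lemma hasNuDeriv_log {h l : ℂ × ℂ → ℂ} {d : ℂ} {p : ℂ × ℂ} (hh : HasNuDeriv h d p)
    (hl : ContinuousAt l p) (he : ∀ᶠ x in 𝓝 p, Complex.exp (l x) = h x) :
    HasNuDeriv l (d / h p) p := by
  obtain ⟨h', hh, rfl⟩ := hh
  have hp : h p ≠ 0 := by
    rw [← he.self_of_nhds]
    exact Complex.exp_ne_zero _
  -- Near `p` the branch is `l p` plus the principal logarithm of `h / h p`.
  have h1 : l =ᶠ[𝓝 p] fun x ↦ l p + Complex.log (h x / h p) := by
    have h2 : ∀ᶠ x in 𝓝 p, ‖l x - l p‖ < Real.pi := by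
      have : Tendsto (fun x ↦ ‖l x - l p‖) (𝓝 p) (𝓝 0) := by
        simpa using (hl.tendsto.sub_const (l p)).norm
      exact this.eventually_lt_const Real.pi_pos
    filter_upwards [h2, he] with x hx hex
    have h3 := (abs_lt.mp ((Complex.abs_im_le_norm _).trans_lt hx))
    rw [← hex, ← he.self_of_nhds, ← Complex.exp_sub, Complex.log_exp h3.1 h3.2.le]
    ring
  have h4 : HasFDerivAt (fun x ↦ Complex.log (h x / h p)) _ p :=
    ((hh.mul_const (h p)⁻¹).clog (by
      simp [mul_inv_cancel₀ hp]))
  refine ⟨_, (h4.const_add (l p)).congr_of_eventuallyEq h1, ?_⟩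
  simp [hp, div_eq_inv_mul]

/-- A continuous nonvanishing function has a continuous logarithm near a point. -/
lemma exists_local_log {h : ℂ × ℂ → ℂ} {p : ℂ × ℂ} (hh : ∀ᶠ x in 𝓝 p, ContinuousAt h x)
    (hp : h p ≠ 0) :
    ∃ l : ℂ × ℂ → ℂ, ∀ᶠ x in 𝓝 p, ContinuousAt l x ∧ Complex.exp (l x) = h x := by
  refine ⟨fun x ↦ Complex.log (h x / h p) + Complex.log (h p), ?_⟩
  have h1 : ∀ᶠ x in 𝓝 p, h x / h p ∈ Complex.slitPlane := by
    have : ContinuousAt (fun x ↦ h x / h p) p := hh.self_of_nhds.div_const _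
    refine this.eventually_mem (Complex.isOpen_slitPlane.mem_nhds ?_)
    simp [div_self hp]
  filter_upwards [hh, h1] with x hx hs
  refine ⟨((hx.div_const _).clog hs).add_const _, ?_⟩
  rw [Complex.exp_add, Complex.exp_log (Complex.slitPlane_ne_zero hs), Complex.exp_log hp,
    div_mul_cancel₀ _ hp]

/-- The polynomial `G` in `∂F_1/∂ν = (ξ/E_4) G(E_2, E_4, E_6)`. -/
noncomputable def genusOnePoly (β : ℂ) : MvPolynomial (Fin 3) ℂ :=
  C (-(1 / 24)) * (X 0 * X 1 - X 2) + C (-((β ^ 2 + (β ^ 2)⁻¹) / 24)) * X 2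

lemma genusOnePoly_mem_isobaric (β : ℂ) : genusOnePoly β ∈ isobaric 6 1 := by
  have h2 := isobaric_mono zero_le_one X2_mem_isobaric
  exact Submodule.add_mem _ (C_mul_mem_isobaric _ (Submodule.sub_mem _
    (isobaric_mul X0_mem_isobaric X1_mem_isobaric) h2)) (C_mul_mem_isobaric _ h2)

lemma dNu_genusOne {β : ℂ} {p : ℂ × ℂ} (hp : p ∈ paramDomain) {F : ℂ × ℂ → ℂ}
    (hF : IsFreeEnergyOneNear β p F) :
    dNu F =ᶠ[𝓝 p] fun x ↦ xiOverE4 x ^ 1 * evalE (genusOnePoly β) x.1 := by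
  obtain ⟨lω, lΔ, c, h⟩ := hF
  filter_upwards [h.eventually_nhds, isOpen_paramDomain.mem_nhds hp] with x hx hxD
  have hx0 := hx.self_of_nhds
  have h2 := hxD.2.2
  have hd := deltaQ_ne_zero (norm_pos_iff.mp hxD.1) hxD.2.1
  have hω := hasNuDeriv_log (hasNuDeriv_snd_zpow h2 1) hx0.1
    (hx.mono fun y hy ↦ by simpa using hy.2.1)
  have hΔ := hasNuDeriv_log ((hasNuDeriv_comp_fst (differentiableAt_deltaQ hxD.2.1)).mul
    (hasNuDeriv_snd_zpow h2 (-12))) hx0.2.2.1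
    (hx.mono fun y hy ↦ by simpa [zpow_neg, div_eq_mul_inv] using hy.2.2.2.1)
  have hF' := (((hω.const_mul (-(1 / 2))).add
    (hΔ.const_mul (-((β ^ 2 + (β ^ 2)⁻¹) / 24)))).add_const c).congr_of_eventuallyEq
    (hx.mono fun y hy ↦ show F y = _ by rw [hy.2.2.2.2]; ring)
  rw [dNu_eq hxD hF', mul_deriv_deltaQ hxD.2.1]
  have h3 : x.2 ^ (-12 : ℤ) ≠ 0 := zpow_ne_zero _ h2
  simp only [evalE, genusOnePoly, map_add, map_mul, map_sub, eval_C, eval_X, zpow_one]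
  simp
  field_simp
  ring

lemma exists_freeEnergyOneNear (β : ℂ) {p : ℂ × ℂ} (hp : p ∈ paramDomain) :
    ∃ F, IsFreeEnergyOneNear β p F := by
  have hD := isOpen_paramDomain.mem_nhds hp
  obtain ⟨lω, hω⟩ := exists_local_log (h := Prod.snd) (p := p)
    (.of_forall fun x ↦ continuous_snd.continuousAt) hp.2.2
  obtain ⟨lΔ, hΔ⟩ := exists_local_log (h := fun x ↦ deltaQ x.1 / x.2 ^ 12) (p := p)
    (by
      filter_upwards [hD] with x hx
      exact ((differentiableAt_deltaQ hx.2.1).continuousAt.comp continuous_fst.continuousAt).div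
        (continuous_snd.continuousAt.pow 12) (pow_ne_zero _ hx.2.2))
    (div_ne_zero (deltaQ_ne_zero (norm_pos_iff.mp hp.1) hp.2.1) (pow_ne_zero _ hp.2.2))
  refine ⟨fun x ↦ -(1 / 2) * lω x - (β ^ 2 + (β ^ 2)⁻¹) / 24 * lΔ x + 0, lω, lΔ, 0, ?_⟩
  filter_upwards [hω, hΔ] with x h1 h2
  exact ⟨h1.1, h1.2, h2.1, h2.2, rfl⟩

end GenusOne

/-! ### The anomaly equation and the gap condition for polynomials -/

section Recursion

open MvPolynomial Filter Asymptotics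

/-- The polynomial `G_h` in `∂F_h/∂ν = (ξ/E_4)^{2h-1} G_h(E_2, E_4, E_6)`. -/
noncomputable def nuDerivOfGenus (β : ℂ) (P : ℕ → MvPolynomial (Fin 3) ℂ) (h : ℕ) :
    MvPolynomial (Fin 3) ℂ :=
  if h = 1 then genusOnePoly β else nuDerivPoly (2 * h - 2) (P h)

/-- The right-hand side of the anomaly equation in genus `g`, divided by `(ξ/E_4)^{2g-2}`. -/
noncomputable def anomalyPoly (β : ℂ) (P : ℕ → MvPolynomial (Fin 3) ℂ) (g : ℕ) :
    MvPolynomial (Fin 3) ℂ :=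
  C (-(1 / 24)) * (nuDerivPoly (2 * (g - 1) - 1) (nuDerivOfGenus β P (g - 1)) +
    ∑ h ∈ Finset.Icc 1 (g - 1), nuDerivOfGenus β P h * nuDerivOfGenus β P (g - h))

variable {β : ℂ} {g : ℕ} {P P' : ℕ → MvPolynomial (Fin 3) ℂ}

lemma anomalyPoly_congr (hg : 2 ≤ g) (h : ∀ k, 2 ≤ k → k < g → P k = P' k) :
    anomalyPoly β P g = anomalyPoly β P' g := by
  have hG : ∀ k, 1 ≤ k → k < g → nuDerivOfGenus β P k = nuDerivOfGenus β P' k := by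
    intro k hk hkg
    unfold nuDerivOfGenus
    split_ifs with h1
    · rfl
    · rw [h k (by omega) hkg]
  have hs : ∑ k ∈ Finset.Icc 1 (g - 1), nuDerivOfGenus β P k * nuDerivOfGenus β P (g - k) =
      ∑ k ∈ Finset.Icc 1 (g - 1), nuDerivOfGenus β P' k * nuDerivOfGenus β P' (g - k) := by
    refine Finset.sum_congr rfl fun k hk ↦ ?_
    rw [Finset.mem_Icc] at hk
    rw [hG k hk.1 (by omega), hG (g - k) (by omega) (by omega)]
  rw [anomalyPoly, anomalyPoly, hG (g - 1) (by omega) (by omega), hs]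

lemma anomalyPoly_mem_isobaric (hg : 2 ≤ g)
    (h : ∀ k, 2 ≤ k → k < g → P k ∈ isobaric (14 * (k - 1)) (3 * (k - 1))) :
    anomalyPoly β P g ∈ isobaric (14 * (g - 2) + 12) (3 * (g - 2) + 2) := by
  have hG : ∀ k, 1 ≤ k → k < g →
      nuDerivOfGenus β P k ∈ isobaric (14 * (k - 1) + 6) (3 * (k - 1) + 1) := by
    intro k hk hkg
    unfold nuDerivOfGenus
    split_ifs with h1
    · subst h1
      exact genusOnePoly_mem_isobaric β
    · exact nuDerivPoly_mem_isobaric _ (h k (by omega) hkg)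
  refine C_mul_mem_isobaric _ (Submodule.add_mem _ ?_ (Submodule.sum_mem _ fun k hk ↦ ?_))
  · exact nuDerivPoly_mem_isobaric _ (hG (g - 1) (by omega) (by omega))
  · rw [Finset.mem_Icc] at hk
    have := isobaric_mul (hG k hk.1 (by omega)) (hG (g - k) (by omega) (by omega))
    rwa [show 14 * (k - 1) + 6 + (14 * (g - k - 1) + 6) = 14 * (g - 2) + 12 by omega,
      show 3 * (k - 1) + 1 + (3 * (g - k - 1) + 1) = 3 * (g - 2) + 2 by omega] at this

lemma anomalyRHS_eq (hg : 2 ≤ g) {F : ℕ → ℂ × ℂ → ℂ}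
    (hF : ∀ k, 2 ≤ k → k < g → ∀ p ∈ paramDomain,
      F k p = xiOverE4 p ^ (2 * k - 2) * evalE (P k) p.1)
    {p : ℂ × ℂ} (hp : p ∈ paramDomain) {F₁ : ℂ × ℂ → ℂ} (hF₁ : IsFreeEnergyOneNear β p F₁) :
    anomalyRHS (Function.update F 1 F₁) g p =
      xiOverE4 p ^ (2 * g - 2) * evalE (anomalyPoly β P g) p.1 := by
  have hG : ∀ k, 1 ≤ k → k < g → dNu (Function.update F 1 F₁ k) =ᶠ[𝓝 p]
      fun x ↦ xiOverE4 x ^ (2 * k - 1) * evalE (nuDerivOfGenus β P k) x.1 := by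
    intro k hk hkg
    unfold nuDerivOfGenus
    split_ifs with h1
    · subst h1
      rw [Function.update_self]
      exact dNu_genusOne hp hF₁
    · rw [Function.update_of_ne h1]
      have := dNu_eventuallyEq hp (k := 2 * k - 2) (P := P k) (F := F k) (by
        filter_upwards [isOpen_paramDomain.mem_nhds hp] with x hx
        exact hF k (by omega) hkg x hx)
      rwa [show 2 * k - 2 + 1 = 2 * k - 1 by omega] at this
  have h2 := (dNu_eventuallyEq hp (hG (g - 1) (by omega) (by omega))).self_of_nhds
  rw [show 2 * (g - 1) - 1 + 1 = 2 * g - 2 by omega] at h2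
  have h3 : ∀ k ∈ Finset.Icc 1 (g - 1),
      dNu (Function.update F 1 F₁ k) p * dNu (Function.update F 1 F₁ (g - k)) p =
      xiOverE4 p ^ (2 * g - 2) *
        (evalE (nuDerivOfGenus β P k) p.1 * evalE (nuDerivOfGenus β P (g - k)) p.1) := by
    intro k hk
    rw [Finset.mem_Icc] at hk
    rw [(hG k hk.1 (by omega)).self_of_nhds, (hG (g - k) (by omega) (by omega)).self_of_nhds,
      show 2 * g - 2 = (2 * k - 1) + (2 * (g - k) - 1) by omega, pow_add]
    ring
  rw [anomalyRHS, h2, Finset.sum_congr rfl h3, ← Finset.mul_sum]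
  simp only [evalE, anomalyPoly, map_mul, map_add, map_sum, eval_C]
  ring

/-- The anomaly equation is an identity of polynomials. -/
lemma holomorphicAnomaly_iff (hg : 2 ≤ g) {F : ℕ → ℂ × ℂ → ℂ}
    (hP : ∀ k, 2 ≤ k → k ≤ g → P k ∈ isobaric (14 * (k - 1)) (3 * (k - 1)))
    (hF : ∀ k, 2 ≤ k → k < g → ∀ p ∈ paramDomain,
      F k p = xiOverE4 p ^ (2 * k - 2) * evalE (P k) p.1) :
    HolomorphicAnomaly β F g (P g) ↔ pderiv 0 (P g) = anomalyPoly β P g := by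
  constructor
  · intro h
    have h1 : pderiv 0 (P g) ∈ isobaric (14 * (g - 2) + 12) (3 * (g - 2) + 2) := by
      refine pderiv_zero_mem_isobaric ?_
      have := hP g hg le_rfl
      rwa [show 14 * (g - 1) = 14 * (g - 2) + 12 + 2 by omega,
        show 3 * (g - 1) = 3 * (g - 2) + 2 + 1 by omega] at this
    refine sub_eq_zero.mp (isobaric_eq_zero_of_evalE (Submodule.sub_mem _ h1
      (anomalyPoly_mem_isobaric (β := β) hg fun k h2 hk ↦ hP k h2 hk.le)) fun q h0 hq ↦ ?_)
    have hp : (q, (1 : ℂ)) ∈ paramDomain := ⟨norm_pos_iff.mpr h0, hq, one_ne_zero⟩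
    obtain ⟨F₁, hF₁⟩ := exists_freeEnergyOneNear β hp
    have h2 := h _ hp F₁ hF₁
    rw [anomalyRHS_eq hg hF hp hF₁] at h2
    have h3 := mul_left_cancel₀ (pow_ne_zero _ (xiOverE4_ne_zero hp)) h2
    simp only [evalE, map_sub] at h3 ⊢
    exact sub_eq_zero.mpr h3
  · intro h p hp F₁ hF₁
    rw [anomalyRHS_eq hg hF hp hF₁, h]

/-- The function `ν ξ / E_4` of `q`, which is a unit at `q = 0`. -/
noncomputable def gapUnit (q : ℂ) : ℂ := deriv (eisensteinQ 2) q / (240 * eulerProd q)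

lemma analyticAt_gapUnit : AnalyticAt ℂ gapUnit 0 :=
  (analyticAt_eisensteinQ 2 (by simp)).deriv.div
    (analyticAt_const.mul analyticAt_eulerProd_zero) (by simp [eulerProd_zero])

lemma gapUnit_zero : gapUnit 0 = 1 := by
  simp [gapUnit, deriv_eisensteinQ_two_zero, eulerProd_zero]

lemma nuParam_mul_xiOverE4 {q ω : ℂ} (h0 : q ≠ 0) (hq : ‖q‖ < 1) (hω : ω ≠ 0) :
    nuParam (q, ω) * xiOverE4 (q, ω) = gapUnit q := by
  have hd := deltaQ_ne_zero h0 hq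
  have h4 := mul_deriv_eisensteinQ_two hq
  have hc := Complex.two_pi_I_ne_zero
  rw [deltaQ_eq_mul_eulerProd] at hd
  have he : eulerProd q ≠ 0 := right_ne_zero_of_mul hd
  rw [nuParam, xiOverE4, gapUnit, deltaQ_eq_mul_eulerProd]
  simp only
  generalize 2 * (Real.pi : ℂ) * Complex.I = c at *
  field_simp
  linear_combination -720 * h4

/-- The gap condition prescribes the Taylor coefficients of `P_g(E_2, E_4, E_6)` below order
`d_g`. -/
lemma weakGap_iff {Fg : ℂ × ℂ → ℂ} {Pg : MvPolynomial (Fin 3) ℂ}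
    (hF : ∀ p ∈ paramDomain, Fg p = xiOverE4 p ^ (2 * g - 2) * evalE Pg p.1) :
    WeakGap β g Fg ↔ (fun q ↦ kappaBeta β g * (gapUnit q ^ (2 * g - 2))⁻¹ - evalE Pg q)
      =O[𝓝[≠] 0] fun q ↦ q ^ gapOrder g := by
  have hu := (analyticAt_gapUnit.pow (2 * g - 2)).continuousAt
  have hu0 : (gapUnit ^ (2 * g - 2)) 0 ≠ 0 := by simp [gapUnit_zero]
  have hne : ∀ᶠ q in 𝓝[≠] 0, gapUnit q ^ (2 * g - 2) ≠ 0 :=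
    nhdsWithin_le_nhds (hu.eventually_ne hu0)
  have h1 : (fun q ↦ gapUnit q ^ (2 * g - 2)) =O[𝓝[≠] 0] fun _ ↦ (1 : ℂ) :=
    (hu.tendsto.isBigO_one ℂ).mono nhdsWithin_le_nhds
  have h2 : (fun q ↦ (gapUnit q ^ (2 * g - 2))⁻¹) =O[𝓝[≠] 0] fun _ ↦ (1 : ℂ) :=
    ((hu.inv₀ hu0).tendsto.isBigO_one ℂ).mono nhdsWithin_le_nhds
  have hν : ∀ ω : ℂ, ω ≠ 0 → ∀ᶠ q in 𝓝[≠] 0, nuParam (q, ω) ^ (2 * g - 2) * Fg (q, ω) =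
      gapUnit q ^ (2 * g - 2) * evalE Pg q := by
    intro ω hω
    filter_upwards [eventually_norm_lt_one, self_mem_nhdsWithin] with q hq h0
    rw [hF (q, ω) ⟨norm_pos_iff.mpr (show q ≠ 0 from h0), hq, hω⟩,
      ← nuParam_mul_xiOverE4 h0 hq hω, mul_pow, mul_assoc]
  constructor
  · intro h
    refine (h2.mul (h 1 one_ne_zero).neg_left).congr' ?_ (.of_forall fun q ↦ one_mul _)
    filter_upwards [hne, hν 1 one_ne_zero] with q hq h3
    rw [h3]
    field_simp
    ring
  · intro h ω hω
    refine (h1.mul h.neg_left).congr' ?_ (.of_forall fun q ↦ one_mul _)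
    filter_upwards [hne, hν ω hω] with q hq h3
    rw [h3]
    field_simp
    ring

/-- The conditions on `P_g` that express the anomaly equation and the gap condition in genus `g`,
the polynomials of lower genus being given. -/
structure SolvesGenus (β : ℂ) (P : ℕ → MvPolynomial (Fin 3) ℂ) (g : ℕ)
    (Q : MvPolynomial (Fin 3) ℂ) : Prop where
  mem : Q ∈ isobaric (14 * (g - 1)) (3 * (g - 1))
  anomaly : pderiv 0 Q = anomalyPoly β P g
  gap : (fun q ↦ kappaBeta β g * (gapUnit q ^ (2 * g - 2))⁻¹ - evalE Q q)
    =O[𝓝[≠] 0] fun q ↦ q ^ gapOrder g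

lemma SolvesGenus.unique {Q Q' : MvPolynomial (Fin 3) ℂ} (hg : 2 ≤ g) (hQ : SolvesGenus β P g Q)
    (hQ' : SolvesGenus β P g Q') : Q' = Q := by
  have h1 : Q' - Q ∈ isobaric (14 * (g - 1)) 0 :=
    mem_isobaric_zero_of_pderiv_eq_zero (Submodule.sub_mem _ hQ'.mem hQ.mem)
      (by rw [map_sub, hQ.anomaly, hQ'.anomaly, sub_self])
  refine sub_eq_zero.mp (eq_zero_of_evalE_isBigO h1 ?_)
  rw [← gapOrder_eq (by omega)]
  refine (hQ.gap.sub hQ'.gap).congr_left fun q ↦ ?_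
  simp only [evalE, map_sub]
  ring

lemma exists_solvesGenus (hg : 2 ≤ g)
    (h : ∀ k, 2 ≤ k → k < g → P k ∈ isobaric (14 * (k - 1)) (3 * (k - 1))) :
    ∃ Q, SolvesGenus β P g Q := by
  obtain ⟨Q, hQ, hQd⟩ := exists_pderiv_zero_eq (anomalyPoly_mem_isobaric (β := β) hg h)
  rw [show 14 * (g - 2) + 12 + 2 = 14 * (g - 1) by omega,
    show 3 * (g - 2) + 2 + 1 = 3 * (g - 1) by omega] at hQ
  -- The gap condition then fixes the holomorphic ambiguity `A`, a form in `E_4` and `E_6`.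
  have hf : AnalyticAt ℂ (fun q ↦ kappaBeta β g * (gapUnit q ^ (2 * g - 2))⁻¹ - evalE Q q) 0 :=
    (analyticAt_const.mul ((analyticAt_gapUnit.pow _).inv (by simp [gapUnit_zero]))).sub
      (analyticAt_evalE Q (by simp))
  obtain ⟨A, hA, hAO⟩ := exists_evalE_isBigO (n := 14 * (g - 1)) ⟨7 * (g - 1), by ring⟩ hf
  refine ⟨Q + A, Submodule.add_mem _ hQ (isobaric_mono (Nat.zero_le _) hA), ?_, ?_⟩
  · rw [map_add, hQd, pderiv_zero_eq_zero_of_mem hA, add_zero]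
  · rw [gapOrder_eq (by omega)]
    refine hAO.congr_left fun q ↦ ?_
    simp only [evalE, map_add]
    ring

/-- The polynomials `P_g`, determined by recursion in `g`. -/
noncomputable def freeEnergyPoly (β : ℂ) (g : ℕ) : MvPolynomial (Fin 3) ℂ :=
  Classical.epsilon (SolvesGenus β (fun h ↦ if h < g then freeEnergyPoly β h else 0) g)

lemma freeEnergyPoly_spec (β : ℂ) (g : ℕ) (hg : 2 ≤ g) :
    SolvesGenus β (freeEnergyPoly β) g (freeEnergyPoly β g) := by
  induction g using Nat.strong_induction_on with | _ g ih =>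
  have h1 := Classical.epsilon_spec (exists_solvesGenus (β := β)
    (P := fun h ↦ if h < g then freeEnergyPoly β h else 0) hg
    (fun k hk hkg ↦ by simpa only [if_pos hkg] using (ih k hkg hk).mem))
  rw [← freeEnergyPoly] at h1
  exact ⟨h1.mem, h1.anomaly.trans (anomalyPoly_congr hg fun k _ hk ↦ if_pos hk), h1.gap⟩

lemma isBetaFreeEnergyAt_iff (hg : 2 ≤ g) {F : ℕ → ℂ × ℂ → ℂ}
    (hP : ∀ k, 2 ≤ k → k < g → HasQuasiModularForm k (F k) (P k)) :
    IsBetaFreeEnergyAt β F P g ↔ SolvesGenus β P g (P g) ∧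
      ∀ p ∈ paramDomain, F g p = xiOverE4 p ^ (2 * g - 2) * evalE (P g) p.1 := by
  have hF := fun k hk hkg ↦ (hP k hk hkg).eq
  have hmem : ∀ k, 2 ≤ k → k < g → P k ∈ isobaric (14 * (k - 1)) (3 * (k - 1)) :=
    fun k hk hkg m hm ↦ ⟨(hP k hk hkg).weight m hm, (hP k hk hkg).depth m hm⟩
  have hmem' : P g ∈ isobaric (14 * (g - 1)) (3 * (g - 1)) →
      ∀ k, 2 ≤ k → k ≤ g → P k ∈ isobaric (14 * (k - 1)) (3 * (k - 1)) := by
    intro h k hk hkg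
    rcases hkg.lt_or_eq with h1 | rfl
    exacts [hmem k hk h1, h]
  constructor
  · intro h
    have h1 : P g ∈ isobaric (14 * (g - 1)) (3 * (g - 1)) :=
      fun m hm ↦ ⟨h.form.weight m hm, h.form.depth m hm⟩
    exact ⟨⟨h1, (holomorphicAnomaly_iff hg (hmem' h1) hF).mp h.hae,
      (weakGap_iff h.form.eq).mp h.gap⟩, h.form.eq⟩
  · rintro ⟨h, he⟩
    exact ⟨⟨fun m hm ↦ (h.mem m hm).1, fun m hm ↦ (h.mem m hm).2, he⟩,
      (holomorphicAnomaly_iff hg (hmem' h.mem) hF).mpr h.anomaly, (weakGap_iff he).mpr h.gap⟩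

end Recursion

theorem theorem5p4 (β : ℂ) (hβ : β ≠ 0) :
    ∃ (F : ℕ → ℂ × ℂ → ℂ) (P : ℕ → MvPolynomial (Fin 3) ℂ),
      (∀ g : ℕ, 2 ≤ g → IsBetaFreeEnergyAt β F P g) ∧
      ∀ (F' : ℕ → ℂ × ℂ → ℂ) (P' : ℕ → MvPolynomial (Fin 3) ℂ) (g : ℕ), 2 ≤ g →
        (∀ h : ℕ, 2 ≤ h → h ≤ g → IsBetaFreeEnergyAt β F' P' h) →
          P' g = P g ∧ Set.EqOn (F' g) (F g) paramDomain := by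
  refine ⟨fun g p ↦ xiOverE4 p ^ (2 * g - 2) * evalE (freeEnergyPoly β g) p.1, freeEnergyPoly β,
    fun g hg ↦ ?_, fun F' P' g hg h ↦ ?_⟩
  · refine (isBetaFreeEnergyAt_iff hg fun k hk _ ↦ ?_).mpr
      ⟨freeEnergyPoly_spec β g hg, fun _ _ ↦ rfl⟩
    have h := (freeEnergyPoly_spec β k hk).mem
    exact ⟨fun m hm ↦ (h m hm).1, fun m hm ↦ (h m hm).2, fun _ _ ↦ rfl⟩
  · have hP : P' g = freeEnergyPoly β g := by
      induction g using Nat.strong_induction_on with | _ g ih =>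
      have h1 := ((isBetaFreeEnergyAt_iff hg fun k hk hkg ↦ (h k hk hkg.le).form).mp
        (h g hg le_rfl)).1
      refine (freeEnergyPoly_spec β g hg).unique hg ⟨h1.mem, h1.anomaly.trans ?_, h1.gap⟩
      exact anomalyPoly_congr hg fun k hk hkg ↦
        ih k hkg hk fun j hj hjk ↦ h j hj (hjk.trans hkg.le)
    refine ⟨hP, fun p hp ↦ ?_⟩
    rw [(h g hg le_rfl).form.eq p hp, hP]
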